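/- Let $G$ be a Lie group of dimension $n\ge 3$ with Lie algebra $\mathfrak g$, such that every left-invariant Riemannian metric on $G$ has non-positive scalar curvature. Let $I=[t_0,\infty)$, let $J\subset\mathbb R$ be an interval with non-empty interior, and let $V,C\in C^1(J)$, $c\in C^0(J)$. Let $\phi\in C^2(I,J)$, let $\gamma\in C^2(I,T^0_2\mathfrak g)$ be a family of Riemannian metrics on $\mathfrak g$, let $\rho\in C^1(I)$, $j\in C^1(I,\mathfrak g^*)$, and let $S\in C^1(I,T^0_2\mathfrak g)$ be symmetric. On $M=G\times I$ (identifying tensors on $\mathfrak g$ with left-invariant tensors on $G$, pulled back to $M$) put $g=\gamma-dt\otimes dt$ and $T=S-j\otimes dt-dt\otimes j+\rho\,dt\otimes dt$, and suppose that $$Rc_g-\tfrac12R_g\,g=\nabla\phi\otimes\nabla\phi-\tfrac12|\nabla\phi|_g^2\,g-V(\phi)\,g+C(\phi)\,T,$$ $$\Box_g\phi-V'(\phi)=-c(\phi)\,\mathrm{tr}_gT,\qquad \mathrm{Div}_g\big(C(\phi)T\big)=c(\phi)(\mathrm{tr}_gT)\nabla\phi .$$ Let $k=-\tfrac12\dot\gamma$,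 $H=-\tfrac1n\mathrm{tr}_\gamma k$, $\sigma=k+H\gamma$, let $R_\gamma$ be the scalar curvature of $\gamma$, and $q=-1-\dot H/H^2$. Assume: - (DEC) $|j|_\gamma\le\rho$ and $|\mathrm{tr}_\gamma S|\le n\rho$; (SEC) $\rho+\mathrm{tr}_\gamma S\ge0$; - $C\ge0$ on $J$ and there is a constant $C_0$ with $|c|\le C_0\,C$ on $J$; - $V>0$ on $J$, and (P1) there is a positive lower semi-continuous function $\bar V$ on the closure of $J$ in $\mathbb R$ with $V\ge\bar V$ on $J$; (P2) $V'$ is bounded on any subset of $J$ on which $V$ is bounded; (P3) $V'$ extends to a continuous function, with values in $\overline{\mathbb R}=\mathbb R\cup\{\pm\infty\}$, on the closure of $J$ in $\overline{\mathbb R}$; - $H(t_0)>0$, and $V_0:=\inf_{t\in I}V(\phi(t))>0$. Let $H_0:=\sqrt{2V_0/(n(n-1))}$. Then: 1. For every $\delta>0$, as $t\to\infty$, $$R_\gamma,\ |\sigma|_\gamma^2,\ C(\phi)\rho,\ C(\phi)|j|_\gamma,\ C(\phi)\,\mathrm{tr}_\gamma S,\ c(\phi)\,\mathrm{tr}_gT=\mathcal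 O\big(e^{-(2-\delta)H_0t}\big).$$ 2. As $t\to\infty$, $H(t)\to H_\infty$ for some $H_\infty\ge H_0>0$, $V(\phi(t))\to\tfrac12n(n-1)H_\infty^2>0$, $V'(\phi(t))\to0$, $\dot\phi(t)\to0$ and $\ddot\phi(t)\to0$. 3. Exponential acceleration and isotropization occur: $q(t)\to-1$ as $t\to\infty$, and for every $\delta>0$, $|\sigma|_\gamma/H=\mathcal O\big(e^{-(1-\delta)H_0t}\big)$. -/

import Mathlib

open Set Filter Topology Asymptotics
open scoped Manifold ContDiff

noncomputable section

namespace Quintessence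

/-! ### Semi-Riemannian geometry in a left-invariant frame

A frame `(e_a)` whose brackets `[e_a, e_b] = ∑ k, lie a b k • e_k` have constant coefficients, on
a manifold with a distinguished time function `t`.  All component functions occurring below depend
on `t` only, so the frame acts on them by `e_a f = dt(e_a) f'`. -/

/-- Data of a frame: range of the time function, structure constants, values `dt(e_a)`. -/
structure Frame (ι : Type*) where
  /-- the range of the time function -/
  I : Set ℝ
  /-- the structure constants: `[e_a, e_b] = ∑ k, lie a b k • e_k` -/
  lie : ι → ι → ι → ℝ
  /-- the components `dt(e_a)` -/
  dt : ι → ℝ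

namespace Frame

variable {ι : Type*} [Fintype ι] [DecidableEq ι]

/-- The derivative `e_a f` of a function of time (one-sided at an end point of `I`). -/
def D (F : Frame ι) (a : ι) (f : ℝ → ℝ) (t : ℝ) : ℝ := F.dt a * derivWithin f F.I t

/-- The coefficient of `e_k` in the Levi-Civita derivative `∇_{e_a} e_b` of the metric with
components `g`, by the Koszul formula. -/
def christoffel (F : Frame ι) (g : ℝ → Matrix ι ι ℝ) (a b k : ι) (t : ℝ) : ℝ :=
  ∑ l, (g t)⁻¹ k l * ((1 / 2) *
    (F.D a (fun s => g s b l) t + F.D b (fun s => g s a l) t - F.D l (fun s => g s a b) t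
      + ∑ m, (F.lie a b m * g t m l - F.lie a l m * g t m b - F.lie b l m * g t m a)))

/-- The coefficient of `e_l` in
`R(e_a, e_b) e_d = ∇_{e_a} ∇_{e_b} e_d - ∇_{e_b} ∇_{e_a} e_d - ∇_{[e_a, e_b]} e_d`. -/
def riemann (F : Frame ι) (g : ℝ → Matrix ι ι ℝ) (a b d l : ι) (t : ℝ) : ℝ :=
  F.D a (F.christoffel g b d l) t - F.D b (F.christoffel g a d l) t
    + ∑ m, (F.christoffel g b d m t * F.christoffel g a m l t
        - F.christoffel g a d m t * F.christoffel g b m l t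
        - F.lie a b m * F.christoffel g m d l t)

/-- The Ricci tensor: `Rc(e_b, e_d)` is the trace of `X ↦ R(X, e_b) e_d`. -/
def ricci (F : Frame ι) (g : ℝ → Matrix ι ι ℝ) (b d : ι) (t : ℝ) : ℝ :=
  ∑ a, F.riemann g a b d a t

/-- The scalar curvature. -/
def scalar (F : Frame ι) (g : ℝ → Matrix ι ι ℝ) (t : ℝ) : ℝ :=
  ∑ a, ∑ b, (g t)⁻¹ a b * F.ricci g a b t

/-- The covariant derivative `(∇_{e_k} T)(e_a, e_b)` of a covariant `2`-tensor field. -/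
def covDeriv (F : Frame ι) (g T : ℝ → Matrix ι ι ℝ) (k a b : ι) (t : ℝ) : ℝ :=
  F.D k (fun s => T s a b) t
    - ∑ l, (F.christoffel g k a l t * T t l b + F.christoffel g k b l t * T t a l)

/-- The divergence `(Div_g T)(e_b)` of a covariant `2`-tensor field. -/
def div (F : Frame ι) (g T : ℝ → Matrix ι ι ℝ) (b : ι) (t : ℝ) : ℝ :=
  ∑ k, ∑ a, (g t)⁻¹ k a * F.covDeriv g T k a b t

/-- The wave operator (Laplace-Beltrami operator) `□_g f` on a function of time. -/
def box (F : Frame ι) (g : ℝ → Matrix ι ι ℝ) (f : ℝ → ℝ) (t : ℝ) : ℝ :=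
  ∑ a, ∑ b, (g t)⁻¹ a b *
    (F.D a (F.D b f) t - ∑ k, F.christoffel g a b k t * F.D k f t)

/-- The square `|∇f|²_g` of the gradient. -/
def gradSq (F : Frame ι) (g : ℝ → Matrix ι ι ℝ) (f : ℝ → ℝ) (t : ℝ) : ℝ :=
  ∑ a, ∑ b, (g t)⁻¹ a b * F.D a f t * F.D b f t

end Frame

/-- The trace `tr_g T = g^{ab} T_{ab}` of a covariant `2`-tensor. -/
def trace {ι : Type*} [Fintype ι] [DecidableEq ι] (g T : Matrix ι ι ℝ) : ℝ :=
  ∑ a, ∑ b, g⁻¹ a b * T a b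

/-- The square `|T|²_g = g^{ac} g^{bd} T_{ab} T_{cd}` of the norm of a covariant `2`-tensor. -/
def normSq {ι : Type*} [Fintype ι] [DecidableEq ι] (g T : Matrix ι ι ℝ) : ℝ :=
  ∑ a, ∑ b, ∑ c, ∑ d, g⁻¹ a c * g⁻¹ b d * T a b * T c d

/-- The norm `|α|_g = (g^{ab} α_a α_b)^{1/2}` of a covector, for a Riemannian metric `g`. -/
def conorm {ι : Type*} [Fintype ι] [DecidableEq ι] (g : Matrix ι ι ℝ) (α : ι → ℝ) : ℝ :=
  Real.sqrt (∑ a, ∑ b, g⁻¹ a b * α a * α b)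

/-! ### Left-invariant metrics -/

section LieAlgebra

variable {n : ℕ} {𝔤 : Type*} [LieRing 𝔤] [LieAlgebra ℝ 𝔤]

/-- The structure constants of a Lie algebra in a basis. -/
def structConst (b : Module.Basis (Fin n) ℝ 𝔤) (i j k : Fin n) : ℝ := b.repr ⁅b i, b j⁆ k

/-- The components of a bilinear form in a basis. -/
def comp (b : Module.Basis (Fin n) ℝ 𝔤) (B : LinearMap.BilinForm ℝ 𝔤) :
    Matrix (Fin n) (Fin n) ℝ :=
  Matrix.of fun i k => B (b i) (b k)

/-- A Riemannian metric on `𝔤`, that is, a left-invariant Riemannian metric on the group. -/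
def IsRiemannian (γ : LinearMap.BilinForm ℝ 𝔤) : Prop :=
  γ.IsSymm ∧ ∀ X, X ≠ 0 → 0 < γ X X

/-- The frame of left-invariant vector fields on the group that extend the basis `b`. -/
def spatialFrame (b : Module.Basis (Fin n) ℝ 𝔤) : Frame (Fin n) where
  I := univ
  lie := structConst b
  dt := 0

/-- The frame `(b_1, …, b_n, ∂_t)` on `G × I`, where `[b_i, ∂_t] = 0`. -/
def spacetimeFrame (b : Module.Basis (Fin n) ℝ 𝔤) (I : Set ℝ) : Frame (Fin n ⊕ Unit) where
  I := I
  lie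
    | .inl i, .inl j, .inl k => structConst b i j k
    | _, _, _ => 0
  dt := Sum.elim 0 1

/-- The scalar curvature `R_γ` of a left-invariant metric `γ`. -/
def scalarCurvature (b : Module.Basis (Fin n) ℝ 𝔤) (γ : LinearMap.BilinForm ℝ 𝔤) : ℝ :=
  (spatialFrame b).scalar (fun _ => comp b γ) 0

/-- Every left-invariant Riemannian metric has non-positive scalar curvature. -/
def NonposScalarCurvature (b : Module.Basis (Fin n) ℝ 𝔤) : Prop :=
  ∀ γ : LinearMap.BilinForm ℝ 𝔤, IsRiemannian γ → scalarCurvature b γ ≤ 0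

end LieAlgebra

/-! ### Coupled quintessence -/

/-- The data of a spatially homogeneous coupled quintessence model on `G × [t₀, ∞)`; tensor
fields are families of tensors on the Lie algebra `𝔤` of `G`, parametrized by time. -/
structure Model (𝔤 : Type*) [LieRing 𝔤] [LieAlgebra ℝ 𝔤] where
  /-- the initial time -/
  t₀ : ℝ
  /-- the interval in which the scalar field takes values -/
  J : Set ℝ
  /-- the potential -/
  V : ℝ → ℝ
  /-- the coupling function of the energy-momentum tensor -/
  C : ℝ → ℝ
  /-- the coupling function of its trace -/
  c : ℝ → ℝ
  /-- the scalar field -/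
  φ : ℝ → ℝ
  /-- the spatial metric -/
  γ : ℝ → LinearMap.BilinForm ℝ 𝔤
  /-- the energy density -/
  ρ : ℝ → ℝ
  /-- the flow covector -/
  j : ℝ → Module.Dual ℝ 𝔤
  /-- the pressure tensor -/
  S : ℝ → LinearMap.BilinForm ℝ 𝔤

namespace Model

variable {n : ℕ} {𝔤 : Type*} [LieRing 𝔤] [LieAlgebra ℝ 𝔤]

/-- The time interval `[t₀, ∞)`. -/
def I (m : Model 𝔤) : Set ℝ := Ici m.t₀

/-- The time derivative of a function on `[t₀, ∞)`. -/
def dot (m : Model 𝔤) (f : ℝ → ℝ) (t : ℝ) : ℝ := derivWithin f m.I t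

/-- The derivative `V'` of the potential on `J`. -/
def dV (m : Model 𝔤) (x : ℝ) : ℝ := derivWithin m.V m.J x

/-- Regularity of the data. -/
structure Regular (m : Model 𝔤) : Prop where
  ordConnected_J : m.J.OrdConnected
  nonempty_interior_J : (interior m.J).Nonempty
  contDiffOn_V : ContDiffOn ℝ 1 m.V m.J
  contDiffOn_C : ContDiffOn ℝ 1 m.C m.J
  continuousOn_c : ContinuousOn m.c m.J
  mapsTo_φ : MapsTo m.φ m.I m.J
  contDiffOn_φ : ContDiffOn ℝ 2 m.φ m.I
  isRiemannian_γ : ∀ t ∈ m.I, IsRiemannian (m.γ t)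
  contDiffOn_γ : ∀ X Y : 𝔤, ContDiffOn ℝ 2 (fun t => m.γ t X Y) m.I
  contDiffOn_ρ : ContDiffOn ℝ 1 m.ρ m.I
  contDiffOn_j : ∀ X : 𝔤, ContDiffOn ℝ 1 (fun t => m.j t X) m.I
  isSymm_S : ∀ t ∈ m.I, (m.S t).IsSymm
  contDiffOn_S : ∀ X Y : 𝔤, ContDiffOn ℝ 1 (fun t => m.S t X Y) m.I

/-- The Lorentzian metric `g = π^*γ - dt ⊗ dt`. -/
def g (m : Model 𝔤) (b : Module.Basis (Fin n) ℝ 𝔤) (t : ℝ) :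
    Matrix (Fin n ⊕ Unit) (Fin n ⊕ Unit) ℝ :=
  Matrix.fromBlocks (comp b (m.γ t)) 0 0 (-1)

/-- The energy-momentum tensor `T = π^*S - π^*j ⊗ dt - dt ⊗ π^*j + ρ dt ⊗ dt`. -/
def T (m : Model 𝔤) (b : Module.Basis (Fin n) ℝ 𝔤) (t : ℝ) :
    Matrix (Fin n ⊕ Unit) (Fin n ⊕ Unit) ℝ :=
  Matrix.fromBlocks (comp b (m.S t)) (Matrix.of fun i _ => -m.j t (b i))
    (Matrix.of fun _ i => -m.j t (b i)) (Matrix.of fun _ _ => m.ρ t)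

/-- The trace `tr_g T`. -/
def trT (m : Model 𝔤) (b : Module.Basis (Fin n) ℝ 𝔤) (t : ℝ) : ℝ := trace (m.g b t) (m.T b t)

/-- The coupled Einstein-scalar field-matter equations on `G × [t₀, ∞)`:
* `Rc_g - ½ R_g g = ∇φ ⊗ ∇φ - ½ |∇φ|²_g g - V(φ) g + C(φ) T`,
* `□_g φ - V'(φ) = - c(φ) tr_g T`,
* `Div_g (C(φ) T) = c(φ) (tr_g T) ∇φ`. -/
structure SolvesESM (m : Model 𝔤) (b : Module.Basis (Fin n) ℝ 𝔤) : Prop where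
  einstein : ∀ t ∈ m.I, ∀ a d : Fin n ⊕ Unit,
    (spacetimeFrame b m.I).ricci (m.g b) a d t
        - (1 / 2) * (spacetimeFrame b m.I).scalar (m.g b) t * m.g b t a d
      = (spacetimeFrame b m.I).D a m.φ t * (spacetimeFrame b m.I).D d m.φ t
        - (1 / 2) * (spacetimeFrame b m.I).gradSq (m.g b) m.φ t * m.g b t a d
        - m.V (m.φ t) * m.g b t a d + m.C (m.φ t) * m.T b t a d
  scalarField : ∀ t ∈ m.I,
    (spacetimeFrame b m.I).box (m.g b) m.φ t - m.dV (m.φ t) = -(m.c (m.φ t) * m.trT b t)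
  matter : ∀ t ∈ m.I, ∀ a : Fin n ⊕ Unit,
    (spacetimeFrame b m.I).div (m.g b) (fun s => m.C (m.φ s) • m.T b s) a t
      = m.c (m.φ t) * m.trT b t * (spacetimeFrame b m.I).D a m.φ t

/-- The tensor `k = - ½ γ̇`. -/
def k (m : Model 𝔤) (b : Module.Basis (Fin n) ℝ 𝔤) (t : ℝ) : Matrix (Fin n) (Fin n) ℝ :=
  Matrix.of fun i l => -(1 / 2) * m.dot (fun s => m.γ s (b i) (b l)) t

/-- The negative `H = - tr_γ k / n` of the mean curvature. -/
def H (m : Model 𝔤) (b : Module.Basis (Fin n) ℝ 𝔤) (t : ℝ) : ℝ :=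
  -trace (comp b (m.γ t)) (m.k b t) / n

/-- The shear tensor `σ = k + H γ`. -/
def σ (m : Model 𝔤) (b : Module.Basis (Fin n) ℝ 𝔤) (t : ℝ) : Matrix (Fin n) (Fin n) ℝ :=
  m.k b t + m.H b t • comp b (m.γ t)

/-- The square `|σ|²_γ` of the norm of the shear. -/
def shearSq (m : Model 𝔤) (b : Module.Basis (Fin n) ℝ 𝔤) (t : ℝ) : ℝ :=
  normSq (comp b (m.γ t)) (m.σ b t)

/-- The trace `tr_γ S`. -/
def trS (m : Model 𝔤) (b : Module.Basis (Fin n) ℝ 𝔤) (t : ℝ) : ℝ :=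
  trace (comp b (m.γ t)) (comp b (m.S t))

/-- The norm `|j|_γ`. -/
def normJ (m : Model 𝔤) (b : Module.Basis (Fin n) ℝ 𝔤) (t : ℝ) : ℝ :=
  conorm (comp b (m.γ t)) (fun i => m.j t (b i))

/-- The deceleration parameter `q = -1 - Ḣ / H²`. -/
def q (m : Model 𝔤) (b : Module.Basis (Fin n) ℝ 𝔤) (t : ℝ) : ℝ :=
  -1 - m.dot (m.H b) t / m.H b t ^ 2

/-- `|j|_γ ≤ ρ` and `|tr_γ S| ≤ n ρ`. -/
def DEC (m : Model 𝔤) (b : Module.Basis (Fin n) ℝ 𝔤) : Prop :=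
  ∀ t ∈ m.I, m.normJ b t ≤ m.ρ t ∧ |m.trS b t| ≤ n * m.ρ t

/-- `ρ + tr_γ S ≥ 0`. -/
def SEC (m : Model 𝔤) (b : Module.Basis (Fin n) ℝ 𝔤) : Prop :=
  ∀ t ∈ m.I, 0 ≤ m.ρ t + m.trS b t

/-- `V` has a positive lower semi-continuous minorant on the closure of `J` in `ℝ`. -/
def P1 (m : Model 𝔤) : Prop :=
  ∃ W : ℝ → ℝ, LowerSemicontinuousOn W (closure m.J) ∧ (∀ x ∈ closure m.J, 0 < W x) ∧
    ∀ x ∈ m.J, W x ≤ m.V x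

/-- `V'` is bounded on every subset of `J` on which `V` is bounded. -/
def P2 (m : Model 𝔤) : Prop :=
  ∀ A ⊆ m.J, Bornology.IsBounded (m.V '' A) → Bornology.IsBounded (m.dV '' A)

/-- `V'` extends to a continuous function with values in the extended reals on the closure of `J`
in the extended reals. -/
def P3 (m : Model 𝔤) : Prop :=
  ∃ W : EReal → EReal, ContinuousOn W (closure ((fun x : ℝ => (x : EReal)) '' m.J)) ∧
    ∀ x ∈ m.J, W (x : EReal) = (m.dV x : EReal)

/-- The infimum `V₀ = inf (V ∘ φ)(I)` of the potential energy density along the solution. -/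
def V₀ (m : Model 𝔤) : ℝ := sInf ((fun t => m.V (m.φ t)) '' m.I)

/-- The constant `H₀ = √(2 V₀ / (n (n - 1)))`. -/
def H₀ (m : Model 𝔤) (n : ℕ) : ℝ := Real.sqrt (2 * m.V₀ / ((n : ℝ) * ((n : ℝ) - 1)))

end Model

end Quintessence

/-- A smooth real Lie group is regular enough for Mathlib's Lie bracket on its Lie algebra. -/
instance Quintessence.leInfty_minSmoothness : ENat.LEInfty (minSmoothness ℝ 3) :=
  ⟨by rw [minSmoothness_of_isRCLikeNormedField]; exact ENat.LEInfty.out⟩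

end

open Quintessence

namespace Quintessence

/-! ### Geometry -/

section Frames

variable {n : ℕ} {𝔤 : Type*} [LieRing 𝔤] [LieAlgebra ℝ 𝔤] (b : Module.Basis (Fin n) ℝ 𝔤)

/-! Spatial homogeneity turns the field equations into ordinary differential equations in `t`. Write
s = |σ|², r = Cρ, p = C tr S, e = c tr T, ψ = φ̇, u = V'(φ). The connection coefficients of γ - dt²
yield the Hamiltonian constraint R + n(n-1)H² - s = ψ² + 2V + 2r, the Raychaudhuri equation for Ḣ,
and ψ̇ + nHψ + u = e; `ReducedSolution` records these together with the sign conditions.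

Since R ≤ 0, the constraint gives H² ≥ H₀², so H stays positive and at least H₀. Raychaudhuri with
(DEC) gives ψ² ≤ -(n-1)Ḣ, so H decreases to a limit and ψ is square integrable. The central quantity
is Z = n(n-1)H² - ψ² - 2V, which by the constraint equals s - R + 2r, a sum of non-negative terms.
The first form can be differentiated with the equations for H and φ; the second gives the sign and,
with (SEC) and n ≥ 3, the inequality Ż ≤ (-2H + C₀|ψ|)Z. Square integrability of ψ makes the
coupling term cost only an arbitrarily small loss of rate (`isBigO_exp_of_deriv_le`), and Z
dominates every quantity in the first claim.

The constraint also bounds V along the solution, hence V' by (P2), hence ψ̇. A Barbalat argument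
(`tendsto_zero_of_sq_le`) gives ψ → 0, and then ψ̇ + u → 0. The field itself need not converge;
`tendsto_force_zero` uses (P3) and compactness of the extended reals to exclude any nonzero limit
value of u, because it would drive ψ away from 0. The remaining limits follow from the constraint
and the Raychaudhuri equation. -/

@[simp] lemma spacetimeFrame_lie_inl (I : Set ℝ) (i j k : Fin n) :
    (spacetimeFrame b I).lie (.inl i) (.inl j) (.inl k) = structConst b i j k := rfl

@[simp] lemma spacetimeFrame_lie_inr_left (I : Set ℝ) (u : Unit) (x y : Fin n ⊕ Unit) :
    (spacetimeFrame b I).lie (.inr u) x y = 0 := rfl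

@[simp] lemma spacetimeFrame_lie_inr_mid (I : Set ℝ) (u : Unit) (x y : Fin n ⊕ Unit) :
    (spacetimeFrame b I).lie x (.inr u) y = 0 := by
  cases x <;> rfl

@[simp] lemma spacetimeFrame_lie_inr_right (I : Set ℝ) (u : Unit) (x y : Fin n ⊕ Unit) :
    (spacetimeFrame b I).lie x y (.inr u) = 0 := by
  cases x <;> cases y <;> rfl

@[simp] lemma spacetimeFrame_D_inl (I : Set ℝ) (i : Fin n) (f : ℝ → ℝ) (t : ℝ) :
    (spacetimeFrame b I).D (.inl i) f t = 0 := by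
  simp [Frame.D, spacetimeFrame]

@[simp] lemma spacetimeFrame_D_inr (I : Set ℝ) (u : Unit) (f : ℝ → ℝ) (t : ℝ) :
    (spacetimeFrame b I).D (.inr u) f t = derivWithin f I t := by
  simp [Frame.D, spacetimeFrame]

@[simp] lemma spatialFrame_D (i : Fin n) (f : ℝ → ℝ) (t : ℝ) :
    (spatialFrame b).D i f t = 0 := by
  simp [Frame.D, spatialFrame]

@[simp] lemma spatialFrame_lie (i j k : Fin n) :
    (spatialFrame b).lie i j k = structConst b i j k := rfl

lemma IsRiemannian.posDef {γ : LinearMap.BilinForm ℝ 𝔤} (h : IsRiemannian γ) :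
    (comp b γ).PosDef := by
  refine Matrix.PosDef.of_dotProduct_mulVec_pos ?_ fun x hx => ?_
  · ext i j
    simpa [comp] using h.1.eq (b j) (b i)
  · have h2 := h.2 (∑ i, x i • b i) (fun h0 => hx <| by
      ext i; exact (Fintype.linearIndependent_iff.1 b.linearIndependent) x h0 i)
    refine lt_of_lt_of_eq h2 ?_
    simp [comp, dotProduct, Matrix.mulVec, map_sum, LinearMap.sum_apply, Finset.mul_sum]
    refine Finset.sum_comm.trans ?_
    refine Finset.sum_congr rfl fun i _ => Finset.sum_congr rfl fun j _ => ?_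
    ring

end Frames

/-! ### Time derivatives of the metric, its inverse and the mean curvature. -/

lemma differentiableWithinAt_det {n : ℕ} {A : ℝ → Matrix (Fin n) (Fin n) ℝ} {I : Set ℝ} {t : ℝ}
    (h : ∀ i l, DifferentiableWithinAt ℝ (fun s => A s i l) I t) :
    DifferentiableWithinAt ℝ (fun s => (A s).det) I t := by
  simp only [Matrix.det_apply]
  refine DifferentiableWithinAt.fun_sum fun p _ => ?_
  exact (DifferentiableWithinAt.fun_finsetProd fun i _ => h (p i) i).const_smul _

/-- By Cramer's rule the entries of the inverse are quotients of determinants in the entries of the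
matrix. -/
lemma differentiableWithinAt_inv_apply {n : ℕ} {A : ℝ → Matrix (Fin n) (Fin n) ℝ} {I : Set ℝ}
    {t : ℝ} (h : ∀ i l, DifferentiableWithinAt ℝ (fun s => A s i l) I t) (h0 : (A t).det ≠ 0)
    (i l : Fin n) : DifferentiableWithinAt ℝ (fun s => (A s)⁻¹ i l) I t := by
  simp only [Matrix.inv_def, Ring.inverse_eq_inv', Matrix.smul_apply, smul_eq_mul]
  refine ((differentiableWithinAt_det h).inv h0).mul ?_
  simp only [Matrix.adjugate_apply]
  refine differentiableWithinAt_det fun p q => ?_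
  simp only [Matrix.updateRow_apply]
  split_ifs
  · exact differentiableWithinAt_const _
  · exact h _ _

namespace Model

variable {n : ℕ} {𝔤 : Type*} [LieRing 𝔤] [LieAlgebra ℝ 𝔤] {m : Model 𝔤}
  (b : Module.Basis (Fin n) ℝ 𝔤)

lemma uniqueDiffOn_I (m : Model 𝔤) : UniqueDiffOn ℝ m.I := uniqueDiffOn_Ici _

lemma Regular.posDef (h : m.Regular) {t : ℝ} (ht : t ∈ m.I) : (comp b (m.γ t)).PosDef :=
  (h.isRiemannian_γ t ht).posDef b

lemma Regular.g_inv (h : m.Regular) {t : ℝ} (ht : t ∈ m.I) :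
    (m.g b t)⁻¹ = Matrix.fromBlocks (comp b (m.γ t))⁻¹ 0 0 (-1) := by
  have hu : IsUnit (comp b (m.γ t)).det := (h.posDef b ht).det_pos.ne'.isUnit
  apply Matrix.inv_eq_right_inv
  rw [g, Matrix.fromBlocks_multiply]
  simp [Matrix.mul_nonsing_inv _ hu]

lemma k_symm (h : m.Regular) {t : ℝ} (ht : t ∈ m.I) (i j : Fin n) :
    m.k b t i j = m.k b t j i := by
  simp only [k, Matrix.of_apply, dot]
  congr 1
  refine derivWithin_congr (fun s hs => ?_) ?_
  · simpa using (h.isRiemannian_γ s hs).1.eq (b i) (b j)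
  · simpa using (h.isRiemannian_γ t ht).1.eq (b i) (b j)

/-- The mixed components of `k`. -/
noncomputable def kMixed (m : Model 𝔤) (b : Module.Basis (Fin n) ℝ 𝔤) (t : ℝ) (i l : Fin n) : ℝ :=
  ∑ p, (comp b (m.γ t))⁻¹ l p * m.k b t i p

/-! ### Connection coefficients of γ - dt². -/

section christoffel

variable (h : m.Regular) {t : ℝ} (ht : t ∈ m.I)
include h ht

/-- Left-invariant fields annihilate functions of time, so only the bracket terms of the Koszul
formula survive, and these see the metric frozen at time `t`. -/
lemma christoffel_inl_inl_inl (i j l : Fin n) :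
    (spacetimeFrame b m.I).christoffel (m.g b) (.inl i) (.inl j) (.inl l) t
      = (spatialFrame b).christoffel (fun _ => comp b (m.γ t)) i j l 0 := by
  simp only [Frame.christoffel, h.g_inv b ht]
  simp [g]

lemma christoffel_inl_inl_inr (i j : Fin n) (u : Unit) :
    (spacetimeFrame b m.I).christoffel (m.g b) (.inl i) (.inl j) (.inr u) t
      = - m.k b t i j := by
  simp only [Frame.christoffel, h.g_inv b ht]
  simp [g, k, dot, comp]

lemma christoffel_inl_inr_inl (i l : Fin n) (u : Unit) :
    (spacetimeFrame b m.I).christoffel (m.g b) (.inl i) (.inr u) (.inl l) t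
      = -m.kMixed b t i l := by
  simp only [Frame.christoffel, h.g_inv b ht]
  simp [g, k, dot, comp, kMixed]

lemma christoffel_inr_inl_inl (i l : Fin n) (u : Unit) :
    (spacetimeFrame b m.I).christoffel (m.g b) (.inr u) (.inl i) (.inl l) t
      = -m.kMixed b t i l := by
  simp only [Frame.christoffel, h.g_inv b ht]
  simp [g, k, dot, comp, kMixed]

lemma christoffel_inl_inr_inr (i : Fin n) (u v : Unit) :
    (spacetimeFrame b m.I).christoffel (m.g b) (.inl i) (.inr u) (.inr v) t = 0 := by
  simp only [Frame.christoffel, h.g_inv b ht]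
  simp [g]

lemma christoffel_inr_inl_inr (i : Fin n) (u v : Unit) :
    (spacetimeFrame b m.I).christoffel (m.g b) (.inr u) (.inl i) (.inr v) t = 0 := by
  simp only [Frame.christoffel, h.g_inv b ht]
  simp [g]

lemma christoffel_inr_inr (u v : Unit) (x : Fin n ⊕ Unit) :
    (spacetimeFrame b m.I).christoffel (m.g b) (.inr u) (.inr v) x t = 0 := by
  simp only [Frame.christoffel, h.g_inv b ht]
  cases x <;> simp [g]

end christoffel

lemma nH_eq (m : Model 𝔤) (hn : n ≠ 0) (t : ℝ) : n * m.H b t = -∑ i, m.kMixed b t i i := by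
  have : (n : ℝ) ≠ 0 := by exact_mod_cast hn
  simp only [H, kMixed, trace]
  field_simp

lemma Regular.hasDerivWithinAt_γ (h : m.Regular) {t : ℝ} (ht : t ∈ m.I) (i l : Fin n) :
    HasDerivWithinAt (fun s => comp b (m.γ s) i l) (-2 * m.k b t i l) m.I t := by
  have h1 := ((h.contDiffOn_γ (b i) (b l)).differentiableOn (by norm_num) t ht).hasDerivWithinAt
  exact h1.congr_deriv (by simp [k, dot])

/-- Differentiate γ⁻¹γ = 1 and solve for the derivative of γ⁻¹, using γ̇ = -2k. -/
lemma Regular.hasDerivWithinAt_inv (h : m.Regular) {t : ℝ} (ht : t ∈ m.I) (i l : Fin n) :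
    HasDerivWithinAt (fun s => (comp b (m.γ s))⁻¹ i l)
      (2 * ∑ p, m.kMixed b t p i * (comp b (m.γ t))⁻¹ p l) m.I t := by
  have hu (s) (hs : s ∈ m.I) : IsUnit (comp b (m.γ s)).det := (h.posDef b hs).det_pos.ne'.isUnit
  have hd (i l) := differentiableWithinAt_inv_apply
    (fun i l => (h.hasDerivWithinAt_γ b ht i l).differentiableWithinAt) (hu t ht).ne_zero i l
  set D : Matrix (Fin n) (Fin n) ℝ :=
    Matrix.of fun i l => derivWithin (fun s => (comp b (m.γ s))⁻¹ i l) m.I t with hD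
  have key : D * comp b (m.γ t) = (2 : ℝ) • ((comp b (m.γ t))⁻¹ * m.k b t) := by
    ext i l
    have h1 : HasDerivWithinAt (fun s => ∑ p, (comp b (m.γ s))⁻¹ i p * comp b (m.γ s) p l)
        (∑ p, (D i p * comp b (m.γ t) p l + (comp b (m.γ t))⁻¹ i p * (-2 * m.k b t p l)))
        m.I t :=
      HasDerivWithinAt.fun_sum fun p _ =>
        (hd i p).hasDerivWithinAt.mul (h.hasDerivWithinAt_γ b ht p l)
    have h2 : HasDerivWithinAt (fun s => ∑ p, (comp b (m.γ s))⁻¹ i p * comp b (m.γ s) p l)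
        0 m.I t := by
      refine (hasDerivWithinAt_const t m.I ((1 : Matrix (Fin n) (Fin n) ℝ) i l)).congr
        (fun s hs => ?_) ?_
      · rw [← Matrix.mul_apply, Matrix.nonsing_inv_mul _ (hu s hs)]
      · rw [← Matrix.mul_apply, Matrix.nonsing_inv_mul _ (hu t ht)]
    have h3 := (m.uniqueDiffOn_I t ht).eq_deriv _ h1 h2
    rw [Finset.sum_add_distrib, ← Matrix.mul_apply] at h3
    rw [eq_neg_of_add_eq_zero_left h3, Matrix.smul_apply, Matrix.mul_apply, smul_eq_mul,
      Finset.mul_sum, ← Finset.sum_neg_distrib]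
    exact Finset.sum_congr rfl fun _ _ => by ring
  have key2 : D = (2 : ℝ) • ((comp b (m.γ t))⁻¹ * m.k b t * (comp b (m.γ t))⁻¹) := by
    rw [← Matrix.smul_mul, ← key, Matrix.mul_assoc, Matrix.mul_nonsing_inv _ (hu t ht),
      Matrix.mul_one]
  refine (hd i l).hasDerivWithinAt.congr_deriv ?_
  change D i l = _
  rw [key2, Matrix.smul_apply, Matrix.mul_apply, smul_eq_mul]
  congr 1
  refine Finset.sum_congr rfl fun p _ => ?_
  rw [Matrix.mul_apply, kMixed]
  congr 1
  exact Finset.sum_congr rfl fun q _ => by rw [k_symm b h ht]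

lemma Regular.differentiableWithinAt_k (h : m.Regular) {t : ℝ} (ht : t ∈ m.I) (i l : Fin n) :
    DifferentiableWithinAt ℝ (fun s => m.k b s i l) m.I t := by
  have h1 := (h.contDiffOn_γ (b i) (b l)).derivWithin m.uniqueDiffOn_I (m := 1) (by norm_num)
  exact ((h1.differentiableOn (by norm_num)) t ht).const_mul _

lemma Regular.differentiableWithinAt_kMixed (h : m.Regular) {t : ℝ} (ht : t ∈ m.I)
    (i l : Fin n) : DifferentiableWithinAt ℝ (fun s => m.kMixed b s i l) m.I t :=
  DifferentiableWithinAt.fun_sum fun _ _ =>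
    (h.hasDerivWithinAt_inv b ht _ _).differentiableWithinAt.mul
      (h.differentiableWithinAt_k b ht _ _)

lemma Regular.differentiableWithinAt_H (h : m.Regular) {t : ℝ} (ht : t ∈ m.I) :
    DifferentiableWithinAt ℝ (m.H b) m.I t := by
  have : m.H b = fun s => -(∑ i, m.kMixed b s i i) / n := by
    ext s; simp only [H, kMixed, trace]
  rw [this]
  exact (DifferentiableWithinAt.fun_sum fun _ _ =>
    h.differentiableWithinAt_kMixed b ht _ _).neg.div_const _

lemma n_dot_H (h : m.Regular) (hn : n ≠ 0) {t : ℝ} (ht : t ∈ m.I) :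
    n * m.dot (m.H b) t = -∑ i, m.dot (fun s => m.kMixed b s i i) t := by
  have h1 : HasDerivWithinAt (fun s => n * m.H b s)
      (-∑ i, m.dot (fun s => m.kMixed b s i i) t) m.I t := by
    rw [funext fun s => nH_eq b m hn s]
    exact (HasDerivWithinAt.fun_sum fun i _ =>
      (h.differentiableWithinAt_kMixed b ht i i).hasDerivWithinAt).neg
  have h2 := ((h.differentiableWithinAt_H b ht).hasDerivWithinAt.const_mul (n : ℝ))
  exact (m.uniqueDiffOn_I t ht).eq_deriv _ h2 h1

/-! ### Curvature of γ - dt² in terms of γ, k and H. -/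

lemma ricci_inr_inr (h : m.Regular) (hn : n ≠ 0) {t : ℝ} (ht : t ∈ m.I) :
    (spacetimeFrame b m.I).ricci (m.g b) (.inr ()) (.inr ()) t
      = -n * m.dot (m.H b) t - ∑ i, ∑ l, m.kMixed b t i l * m.kMixed b t l i := by
  -- The formula for the connection coefficient holds at every time in `m.I`, so it may be
  -- differentiated within `m.I`.
  have h1 (i : Fin n) : derivWithin
      ((spacetimeFrame b m.I).christoffel (m.g b) (.inl i) (.inr ()) (.inl i)) m.I t
      = -m.dot (fun s => m.kMixed b s i i) t := by
    rw [dot, ← derivWithin.fun_neg]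
    exact derivWithin_congr (fun s hs => christoffel_inl_inr_inl b h hs i i ())
      (christoffel_inl_inr_inl b h ht i i ())
  rw [neg_mul, n_dot_H b h hn ht]
  simp only [Frame.ricci, Frame.riemann, Fintype.sum_sum_type, Finset.univ_unique,
    Finset.sum_singleton, PUnit.default_eq_unit]
  simp [h1, christoffel_inl_inr_inl b h ht, christoffel_inr_inl_inl b h ht,
    christoffel_inr_inr b h ht, christoffel_inl_inr_inr b h ht, Finset.sum_add_distrib,
    sub_eq_add_neg]

/-- The last two sums agree by symmetry of k; they are kept apart as they arise from different
products of connection coefficients. -/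
lemma ricci_inl_inl (h : m.Regular) (hn : n ≠ 0) {t : ℝ} (ht : t ∈ m.I) (i j : Fin n) :
    (spacetimeFrame b m.I).ricci (m.g b) (.inl i) (.inl j) t
      = (spatialFrame b).ricci (fun _ => comp b (m.γ t)) i j 0
        - n * m.H b t * m.k b t i j - m.dot (fun s => m.k b s i j) t
        - ∑ l, m.k b t l j * m.kMixed b t i l - ∑ l, m.kMixed b t j l * m.k b t i l := by
  have h1 : derivWithin
      ((spacetimeFrame b m.I).christoffel (m.g b) (.inl i) (.inl j) (.inr ())) m.I t
      = -m.dot (fun s => m.k b s i j) t := by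
    rw [dot, ← derivWithin.fun_neg]
    exact derivWithin_congr (fun s hs => christoffel_inl_inl_inr b h hs i j ())
      (christoffel_inl_inl_inr b h ht i j ())
  rw [nH_eq b m hn]
  simp only [Frame.ricci, Frame.riemann, Fintype.sum_sum_type, Finset.univ_unique,
    Finset.sum_singleton, PUnit.default_eq_unit]
  simp [h1, christoffel_inl_inr_inl b h ht, christoffel_inr_inl_inl b h ht,
    christoffel_inr_inr b h ht, christoffel_inl_inr_inr b h ht, christoffel_inl_inl_inl b h ht,
    christoffel_inl_inl_inr b h ht, christoffel_inr_inl_inr b h ht, 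
    Finset.sum_add_distrib, Finset.sum_sub_distrib]
  simp only [mul_comm, ← Finset.mul_sum]
  ring

/-- The square of the norm of `k`, as the trace of the square of the mixed tensor. -/
noncomputable def kSq (m : Model 𝔤) (b : Module.Basis (Fin n) ℝ 𝔤) (t : ℝ) : ℝ :=
  ∑ i, ∑ l, m.kMixed b t i l * m.kMixed b t l i

lemma inv_symm (h : m.Regular) {t : ℝ} (ht : t ∈ m.I) (i l : Fin n) :
    (comp b (m.γ t))⁻¹ i l = (comp b (m.γ t))⁻¹ l i := by
  simpa using ((h.posDef b ht).inv.isHermitian.apply i l).symm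

/-- The mixed form of σ is that of k plus H times the identity. Squaring and taking the trace gives
|k|² + 2H tr k + nH², with tr k = -nH. -/
lemma shearSq_eq (h : m.Regular) (hn : n ≠ 0) {t : ℝ} (ht : t ∈ m.I) :
    m.shearSq b t = m.kSq b t - n * m.H b t ^ 2 := by
  have hu : IsUnit (comp b (m.γ t)).det := (h.posDef b ht).det_pos.ne'.isUnit
  have h1 (i l : Fin n) : ∑ p, (comp b (m.γ t))⁻¹ l p * m.σ b t i p
      = m.kMixed b t i l + if l = i then m.H b t else 0 := by
    have h2 : ∑ p, (comp b (m.γ t))⁻¹ l p * comp b (m.γ t) p i = if l = i then 1 else 0 := by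
      rw [← Matrix.mul_apply, Matrix.nonsing_inv_mul _ hu, Matrix.one_apply]
    rw [← mul_boole, ← h2, kMixed, Finset.mul_sum, ← Finset.sum_add_distrib]
    refine Finset.sum_congr rfl fun p _ => ?_
    have h3 : comp b (m.γ t) i p = comp b (m.γ t) p i :=
      (h.isRiemannian_γ t ht).1.eq (b i) (b p)
    simp only [σ, Matrix.add_apply, Matrix.smul_apply, smul_eq_mul, h3]
    ring
  have hs (i l : Fin n) : m.σ b t i l = m.σ b t l i := by
    have h3 : comp b (m.γ t) i l = comp b (m.γ t) l i :=
      (h.isRiemannian_γ t ht).1.eq (b i) (b l)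
    simp only [σ, Matrix.add_apply, Matrix.smul_apply, h3, k_symm b h ht i l]
  have h4 : m.shearSq b t = ∑ i, ∑ l, (∑ p, (comp b (m.γ t))⁻¹ l p * m.σ b t i p)
      * ∑ p, (comp b (m.γ t))⁻¹ i p * m.σ b t l p := by
    rw [shearSq, normSq]
    refine Finset.sum_congr rfl fun i _ => ?_
    simp only [Finset.sum_mul_sum]
    conv_rhs => rw [Finset.sum_comm]
    refine Finset.sum_congr rfl fun p _ => ?_
    rw [Finset.sum_comm]
    refine Finset.sum_congr rfl fun l _ => Finset.sum_congr rfl fun q _ => ?_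
    rw [hs l q, inv_symm b h ht l p]
    ring
  have h5 : ∑ i, m.kMixed b t i i = -(n * m.H b t) := by rw [nH_eq b m hn, neg_neg]
  simp only [h4, h1, kSq, add_mul, mul_add, Finset.sum_add_distrib]
  simp [← Finset.mul_sum, ← Finset.sum_mul, h5]
  ring

/-- The norm is the quadratic form of γ⁻¹ ⊗ γ⁻¹, and a Kronecker product of positive definite
matrices is positive definite. -/
lemma shearSq_nonneg (h : m.Regular) {t : ℝ} (ht : t ∈ m.I) : 0 ≤ m.shearSq b t := by
  have h1 := (h.posDef b ht).inv
  have h2 := (h1.kronecker h1).posSemidef.dotProduct_mulVec_nonneg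
    (fun p : Fin n × Fin n => m.σ b t p.1 p.2)
  refine h2.trans_eq ?_
  simp only [shearSq, normSq, dotProduct, Matrix.mulVec, Fintype.sum_prod_type,
    Matrix.kroneckerMap_apply, Finset.mul_sum]
  refine Finset.sum_congr rfl fun _ _ => Finset.sum_congr rfl fun _ _ =>
    Finset.sum_congr rfl fun _ _ => Finset.sum_congr rfl fun _ _ => ?_
  simp
  ring

/-- Differentiate tr k = -nH; the derivative of γ⁻¹ contributes 2|k|². -/
lemma sum_inv_mul_dot_k (h : m.Regular) (hn : n ≠ 0) {t : ℝ} (ht : t ∈ m.I) :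
    ∑ i, ∑ l, (comp b (m.γ t))⁻¹ i l * m.dot (fun s => m.k b s i l) t
      = -n * m.dot (m.H b) t - 2 * m.kSq b t := by
  have h1 (i : Fin n) : m.dot (fun s => m.kMixed b s i i) t
      = 2 * ∑ q, m.kMixed b t q i * m.kMixed b t i q
        + ∑ p, (comp b (m.γ t))⁻¹ i p * m.dot (fun s => m.k b s i p) t := by
    have h2 : HasDerivWithinAt (fun s => m.kMixed b s i i) (∑ p,
        (2 * (∑ q, m.kMixed b t q i * (comp b (m.γ t))⁻¹ q p) * m.k b t i p
          + (comp b (m.γ t))⁻¹ i p * m.dot (fun s => m.k b s i p) t)) m.I t :=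
      HasDerivWithinAt.fun_sum fun p _ => (h.hasDerivWithinAt_inv b ht i p).mul
        (h.differentiableWithinAt_k b ht i p).hasDerivWithinAt
    rw [dot, h2.derivWithin (m.uniqueDiffOn_I t ht), Finset.sum_add_distrib]
    congr 1
    simp only [Finset.mul_sum, Finset.sum_mul]
    rw [Finset.sum_comm]
    refine Finset.sum_congr rfl fun q _ => ?_
    conv_rhs => rw [kMixed.eq_def m b t i q]
    simp only [Finset.mul_sum]
    exact Finset.sum_congr rfl fun p _ => by ring
  have h3 := n_dot_H b h hn ht
  simp only [h1, Finset.sum_add_distrib, ← Finset.mul_sum] at h3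
  rw [neg_mul, h3, kSq, Finset.sum_comm (f := fun i l => m.kMixed b t i l * m.kMixed b t l i)]
  ring

/-- In the spatial trace of the Ricci tensor the |k|² from k̇ cancels the two quadratic terms; the
one that remains comes from -Rc(∂_t, ∂_t). -/
lemma scalar_eq (h : m.Regular) (hn : n ≠ 0) {t : ℝ} (ht : t ∈ m.I) :
    (spacetimeFrame b m.I).scalar (m.g b) t
      = scalarCurvature b (m.γ t) + n ^ 2 * m.H b t ^ 2 + 2 * n * m.dot (m.H b) t
        + m.kSq b t := by
  have h1 : ∑ i, ∑ j, (comp b (m.γ t))⁻¹ i j * m.k b t i j = -(n * m.H b t) := by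
    rw [nH_eq b m hn, neg_neg]; rfl
  have h2 : ∑ i, ∑ j, (comp b (m.γ t))⁻¹ i j * ∑ l, m.k b t l j * m.kMixed b t i l
      = m.kSq b t := by
    refine Finset.sum_congr rfl fun i _ => ?_
    simp only [Finset.mul_sum]
    rw [Finset.sum_comm]
    refine Finset.sum_congr rfl fun l _ => ?_
    rw [kMixed.eq_def m b t l i, Finset.mul_sum]
    exact Finset.sum_congr rfl fun j _ => by ring
  have h3 : ∑ i, ∑ j, (comp b (m.γ t))⁻¹ i j * ∑ l, m.kMixed b t j l * m.k b t i l
      = m.kSq b t := by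
    rw [Finset.sum_comm, ← h2]
    refine Finset.sum_congr rfl fun i _ => Finset.sum_congr rfl fun j _ => ?_
    rw [inv_symm b h ht j i]
    congr 1
    exact Finset.sum_congr rfl fun l _ => by rw [k_symm b h ht j l]; ring
  have h4 := sum_inv_mul_dot_k b h hn ht
  have h5 := ricci_inr_inr b h hn ht
  have h6 : ∑ i, ∑ j, (comp b (m.γ t))⁻¹ i j
      * (spatialFrame b).ricci (fun _ => comp b (m.γ t)) i j 0 = scalarCurvature b (m.γ t) := rfl
  have h7 : ∑ i, ∑ j, (comp b (m.γ t))⁻¹ i j * (n * m.H b t * m.k b t i j)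
      = n * m.H b t * -(n * m.H b t) := by
    rw [← h1]
    simp only [Finset.mul_sum]
    exact Finset.sum_congr rfl fun i _ => Finset.sum_congr rfl fun j _ => by ring
  rw [← kSq] at h5
  have h8 : (spacetimeFrame b m.I).scalar (m.g b) t
      = ∑ i, ∑ j, (comp b (m.γ t))⁻¹ i j
          * (spacetimeFrame b m.I).ricci (m.g b) (.inl i) (.inl j) t
        - (spacetimeFrame b m.I).ricci (m.g b) (.inr ()) (.inr ()) t := by
    simp only [Frame.scalar, h.g_inv b ht]
    simp [sub_eq_add_neg]
  simp only [h8, h5, ricci_inl_inl b h hn ht, mul_sub, Finset.sum_sub_distrib, h2, h3, h4, h6, h7]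
  ring

lemma gradSq_eq (h : m.Regular) {t : ℝ} (ht : t ∈ m.I) (f : ℝ → ℝ) :
    (spacetimeFrame b m.I).gradSq (m.g b) f t = -m.dot f t ^ 2 := by
  simp only [Frame.gradSq, h.g_inv b ht]
  simp [dot]
  ring

lemma box_eq (h : m.Regular) (hn : n ≠ 0) {t : ℝ} (ht : t ∈ m.I) (f : ℝ → ℝ) :
    (spacetimeFrame b m.I).box (m.g b) f t
      = -m.dot (m.dot f) t - n * m.H b t * m.dot f t := by
  have h1 : ∑ i, ∑ j, (comp b (m.γ t))⁻¹ i j * m.k b t i j = -(n * m.H b t) := by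
    rw [nH_eq b m hn, neg_neg]; rfl
  have h2 : (spacetimeFrame b m.I).D (.inr ()) f = m.dot f :=
    funext fun s => spacetimeFrame_D_inr b m.I () f s
  have h3 : ∑ i, ∑ j, (comp b (m.γ t))⁻¹ i j * (m.k b t i j * m.dot f t)
      = -(n * m.H b t) * m.dot f t := by
    rw [← h1]
    simp only [Finset.sum_mul]
    exact Finset.sum_congr rfl fun i _ => Finset.sum_congr rfl fun j _ => by ring
  simp only [Frame.box, h.g_inv b ht, Fintype.sum_sum_type, Finset.univ_unique,
    Finset.sum_singleton, PUnit.default_eq_unit, Matrix.fromBlocks_apply₁₁,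
    Matrix.fromBlocks_apply₁₂, Matrix.fromBlocks_apply₂₁, Matrix.fromBlocks_apply₂₂, h2,
    christoffel_inl_inl_inr b h ht, christoffel_inr_inr b h ht]
  simp only [spacetimeFrame_D_inl, spacetimeFrame_D_inr,
    show ∀ f, derivWithin f m.I t = m.dot f t from fun _ => rfl]
  simp [h3]
  ring

lemma trT_eq (h : m.Regular) {t : ℝ} (ht : t ∈ m.I) : m.trT b t = m.trS b t - m.ρ t := by
  rw [trT, trace, h.g_inv b ht]
  simp [T, trS, trace]
  ring

lemma trace_g (h : m.Regular) {t : ℝ} (ht : t ∈ m.I) :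
    trace (m.g b t) (m.g b t) = n + 1 := by
  have hu : IsUnit (comp b (m.γ t)).det := (h.posDef b ht).det_pos.ne'.isUnit
  have h1 : ∑ i, ∑ j, (comp b (m.γ t))⁻¹ i j * comp b (m.γ t) i j = n := by
    have h2 : ∑ i, ((comp b (m.γ t))⁻¹ * comp b (m.γ t)) i i = n := by
      simp [Matrix.nonsing_inv_mul _ hu]
    rw [← h2]
    refine Finset.sum_congr rfl fun i _ => ?_
    rw [Matrix.mul_apply]
    refine Finset.sum_congr rfl fun j _ => ?_
    rw [show comp b (m.γ t) i j = comp b (m.γ t) j i from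
      (h.isRiemannian_γ t ht).1.eq (b i) (b j)]
  rw [trace, h.g_inv b ht]
  simp [g, h1]

/-- The Hamiltonian constraint. -/
lemma SolvesESM.hamiltonian (hE : m.SolvesESM b) (h : m.Regular) (hn : n ≠ 0) {t : ℝ}
    (ht : t ∈ m.I) :
    scalarCurvature b (m.γ t) + n * (n - 1) * m.H b t ^ 2 - m.shearSq b t
      = m.dot m.φ t ^ 2 + 2 * m.V (m.φ t) + 2 * (m.C (m.φ t) * m.ρ t) := by
  have h1 := hE.einstein t ht (.inr ()) (.inr ())
  -- In the tt-component of the Einstein tensor Ḣ cancels, which leaves a constraint.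
  rw [ricci_inr_inr b h hn ht, scalar_eq b h hn ht, gradSq_eq b h ht, ← kSq] at h1
  simp only [spacetimeFrame_D_inr] at h1
  simp [g, T, show derivWithin m.φ m.I t = m.dot m.φ t from rfl] at h1
  rw [shearSq_eq b h hn ht]
  linarith

/-- The trace of the Einstein equations. -/
lemma SolvesESM.scalar_eq (hE : m.SolvesESM b) (h : m.Regular) {t : ℝ} (ht : t ∈ m.I) :
    (1 - n) * (spacetimeFrame b m.I).scalar (m.g b) t
      = (n - 1) * m.dot m.φ t ^ 2 - 2 * (n + 1) * m.V (m.φ t)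
        + 2 * (m.C (m.φ t) * (m.trS b t - m.ρ t)) := by
  have h1 : ∑ a, ∑ d, (m.g b t)⁻¹ a d * _ = ∑ a, ∑ d, (m.g b t)⁻¹ a d * _ :=
    Finset.sum_congr rfl fun a _ => Finset.sum_congr rfl fun d _ =>
      congrArg ((m.g b t)⁻¹ a d * ·) (hE.einstein t ht a d)
  have h2 : ∑ a, ∑ d, (m.g b t)⁻¹ a d * m.g b t a d = n + 1 := trace_g b h ht
  have h3 : ∑ a, ∑ d, (m.g b t)⁻¹ a d * m.T b t a d = m.trS b t - m.ρ t := trT_eq b h ht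
  have h4 : ∑ a, ∑ d, (m.g b t)⁻¹ a d * (spacetimeFrame b m.I).ricci (m.g b) a d t
      = (spacetimeFrame b m.I).scalar (m.g b) t := rfl
  have h5 : ∑ a, ∑ d, (m.g b t)⁻¹ a d * ((spacetimeFrame b m.I).D a m.φ t
      * (spacetimeFrame b m.I).D d m.φ t) = -m.dot m.φ t ^ 2 := by
    rw [← gradSq_eq b h ht]
    exact Finset.sum_congr rfl fun a _ => Finset.sum_congr rfl fun d _ => (mul_assoc _ _ _).symm
  have h6 (x : ℝ) (B : Matrix (Fin n ⊕ Unit) (Fin n ⊕ Unit) ℝ) :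
      ∑ a, ∑ d, (m.g b t)⁻¹ a d * (x * B a d) = x * ∑ a, ∑ d, (m.g b t)⁻¹ a d * B a d := by
    simp only [Finset.mul_sum, mul_left_comm]
  simp only [mul_sub, mul_add, Finset.sum_sub_distrib, Finset.sum_add_distrib, h6, h2, h3, h4,
    h5, gradSq_eq b h ht] at h1
  linarith

/-- The Raychaudhuri equation. -/
lemma SolvesESM.raychaudhuri (hE : m.SolvesESM b) (h : m.Regular) (hn : 3 ≤ n) {t : ℝ}
    (ht : t ∈ m.I) :
    -(n * (n - 1) * m.dot (m.H b) t)
      = -scalarCurvature b (m.γ t) + n * (m.shearSq b t + m.dot m.φ t ^ 2)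
        + (n * (m.C (m.φ t) * m.ρ t) + m.C (m.φ t) * m.trS b t) := by
  have hn0 : n ≠ 0 := by omega
  have h1 := hE.hamiltonian b h hn0 ht
  have h2 := hE.scalar_eq b h ht
  rw [Model.scalar_eq b h hn0 ht] at h2
  have h3 := shearSq_eq b h hn0 ht
  -- The weight (n+1)/2 eliminates the potential, and the last term trades |k|² for the shear; the
  -- terms in H² then cancel.
  linear_combination ((n + 1 : ℝ) / 2) * h1 + h2 / 2 + ((1 - n : ℝ) / 2) * h3

/-- The scalar field equation. -/
lemma SolvesESM.scalarField_eq (hE : m.SolvesESM b) (h : m.Regular) (hn : n ≠ 0) {t : ℝ}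
    (ht : t ∈ m.I) :
    m.dot (m.dot m.φ) t + n * m.H b t * m.dot m.φ t + m.dV (m.φ t)
      = m.c (m.φ t) * (m.trS b t - m.ρ t) := by
  have h1 := hE.scalarField t ht
  rw [box_eq b h hn ht, trT_eq b h ht] at h1
  linarith

end Model

/-! ### Analysis on a half-line -/

section HalfLine

variable {t₀ : ℝ}

lemma antitoneOn_Ici_of_hasDerivWithinAt {f f' : ℝ → ℝ}
    (hf : ∀ t ∈ Ici t₀, HasDerivWithinAt f (f' t) (Ici t₀) t) (hf' : ∀ t ∈ Ici t₀, f' t ≤ 0) :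
    AntitoneOn f (Ici t₀) :=
  antitoneOn_of_hasDerivWithinAt_nonpos (convex_Ici t₀)
    (fun t ht => (hf t ht).continuousWithinAt)
    (fun t ht => (hf t (interior_subset ht)).mono interior_subset)
    (fun t ht => hf' t (interior_subset ht))

lemma exists_tendsto_of_antitoneOn_Ici {f : ℝ → ℝ} {L₀ : ℝ} (hf : AntitoneOn f (Ici t₀))
    (hL : ∀ t ∈ Ici t₀, L₀ ≤ f t) : ∃ L, L₀ ≤ L ∧ Tendsto f atTop (𝓝 L) := by
  have h1 : Antitone fun t => f (max t₀ t) := fun s t hst =>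
    hf (le_max_left t₀ s) (le_max_left t₀ t) (max_le_max le_rfl hst)
  have h2 : Tendsto (fun t => f (max t₀ t)) atTop (𝓝 (⨅ t, f (max t₀ t))) :=
    tendsto_atTop_ciInf h1 ⟨L₀, by rintro _ ⟨t, rfl⟩; exact hL _ (le_max_left t₀ t)⟩
  refine ⟨_, le_ciInf fun t => hL _ (le_max_left t₀ t), h2.congr' ?_⟩
  filter_upwards [eventually_ge_atTop t₀] with t ht
  rw [max_eq_right ht]

lemma abs_sub_le_of_hasDerivWithinAt_Ici {f f' : ℝ → ℝ} {B a s : ℝ}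
    (hf : ∀ t ∈ Ici t₀, HasDerivWithinAt f (f' t) (Ici t₀) t) (ha : t₀ ≤ a) (has : a ≤ s)
    (hB : ∀ t ∈ Icc a s, |f' t| ≤ B) : |f s - f a| ≤ B * (s - a) := by
  have h := (convex_Icc a s).norm_image_sub_le_of_norm_hasDerivWithin_le (f := f) (f' := f')
    (fun t ht => (hf t (ha.trans ht.1)).mono fun u hu => ha.trans hu.1) hB
    (left_mem_Icc.2 has) (right_mem_Icc.2 has)
  simpa [Real.norm_eq_abs, abs_of_nonneg (sub_nonneg.2 has)] using h

/-- A differential inequality `Ż ≤ (-2H + K |ψ|) Z` with square-integrable `ψ` implies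
exponential decay of `Z`. -/
lemma isBigO_exp_of_deriv_le {Z Z' H H' ψ : ℝ → ℝ} {K a H₀ : ℝ}
    (hZ : ∀ t ∈ Ici t₀, HasDerivWithinAt Z (Z' t) (Ici t₀) t)
    (hH : ∀ t ∈ Ici t₀, HasDerivWithinAt H (H' t) (Ici t₀) t)
    (hZ0 : ∀ t ∈ Ici t₀, 0 ≤ Z t) (ha : 0 < a) (hH₀ : 0 < H₀) (hHH₀ : ∀ t ∈ Ici t₀, H₀ ≤ H t)
    (hψ : ∀ t ∈ Ici t₀, ψ t ^ 2 ≤ -(a * H' t))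
    (hle : ∀ t ∈ Ici t₀, Z' t ≤ (-2 * H t + K * |ψ t|) * Z t) {δ : ℝ} (hδ : 0 < δ) :
    Z =O[atTop] fun t => Real.exp (-(2 - δ) * H₀ * t) := by
  set ε := δ * H₀ with hε
  have hε0 : 0 < ε := by positivity
  -- Young's inequality K|ψ| ≤ ε + K²ψ²/(4ε) and the bound on ψ² give K|ψ| ≤ ε - A H'. The weight
  -- exp(A H) in `F` absorbs the second term, and ε is the loss of rate.
  set A := K ^ 2 * a / (4 * ε) with hA
  have hA0 : 0 ≤ A := by positivity
  set F : ℝ → ℝ := fun t => Z t * Real.exp ((2 * H₀ - ε) * t + A * H t)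
  have hF : AntitoneOn F (Ici t₀) := by
    refine antitoneOn_Ici_of_hasDerivWithinAt (fun t ht => (hZ t ht).mul
      ((((hasDerivWithinAt_id t _).const_mul (2 * H₀ - ε)).add
        ((hH t ht).const_mul A)).exp)) fun t ht => ?_
    have h1 : K * |ψ t| ≤ ε - A * H' t := by
      have h2 : K ^ 2 * |ψ t| ^ 2 ≤ 4 * ε * (-(A * H' t)) := by
        have : 4 * ε * (-(A * H' t)) = K ^ 2 * -(a * H' t) := by
          rw [hA]; field_simp
        rw [this, sq_abs]
        exact mul_le_mul_of_nonneg_left (hψ t ht) (sq_nonneg K)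
      nlinarith [sq_nonneg (K * |ψ t| - 2 * ε)]
    have h3 : Z' t + Z t * (2 * H₀ - ε + A * H' t) ≤ 0 := by
      have := hle t ht
      nlinarith [mul_nonneg (hZ0 t ht) (sub_nonneg.2 h1),
        mul_nonneg (hZ0 t ht) (sub_nonneg.2 (hHH₀ t ht))]
    have h4 := mul_nonpos_of_nonpos_of_nonneg h3
      (Real.exp_pos ((2 * H₀ - ε) * t + A * H t)).le
    simp only [Pi.add_apply, id] at *
    linarith
  refine IsBigO.of_bound (F t₀) ?_
  filter_upwards [eventually_ge_atTop t₀] with t ht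
  rw [Real.norm_of_nonneg (hZ0 t ht), Real.norm_of_nonneg (Real.exp_pos _).le]
  have h1 := hF self_mem_Ici ht ht
  -- As A H ≥ 0, the weight exp(A H) is at least 1 and can be dropped.
  have h2 : Z t * Real.exp ((2 * H₀ - ε) * t) ≤ F t := by
    refine mul_le_mul_of_nonneg_left (Real.exp_le_exp.2 ?_) (hZ0 t ht)
    have := mul_nonneg hA0 (hH₀.le.trans (hHH₀ t ht))
    linarith
  have h3 : Real.exp (-(2 - δ) * H₀ * t) = (Real.exp ((2 * H₀ - ε) * t))⁻¹ := by
    rw [← Real.exp_neg, hε]; ring_nf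
  rw [h3, ← div_eq_mul_inv, le_div_iff₀ (Real.exp_pos _)]
  exact h2.trans h1

/-- A function with bounded derivative, whose square is dominated by the derivative of a
convergent function, tends to zero. -/
lemma tendsto_zero_of_sq_le {H H' ψ ψ' : ℝ → ℝ} {a B L : ℝ} (ha : 0 < a)
    (hH : ∀ t ∈ Ici t₀, HasDerivWithinAt H (H' t) (Ici t₀) t)
    (hψ : ∀ t ∈ Ici t₀, HasDerivWithinAt ψ (ψ' t) (Ici t₀) t)
    (hB : ∀ t ∈ Ici t₀, |ψ' t| ≤ B) (hle : ∀ t ∈ Ici t₀, ψ t ^ 2 ≤ -(a * H' t))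
    (hL : Tendsto H atTop (𝓝 L)) : Tendsto ψ atTop (𝓝 0) := by
  wlog hB0 : 0 < B generalizing B
  · exact this (B := |B| + 1) (fun t ht => (hB t ht).trans (by linarith [le_abs_self B]))
      (by positivity)
  rw [Metric.tendsto_nhds]
  intro ε hε
  -- If |ψ| ≥ ε at some time, then |ψ| ≥ ε/2 for a further time h, so H falls by at least ε²h/(4a).
  -- This is impossible at late times because H converges.
  set h := ε / (2 * B) with hh
  have hh0 : 0 < h := by positivity
  have h1 : Tendsto (fun t => H t - H (t + h)) atTop (𝓝 0) := by
    simpa using hL.sub (hL.comp (tendsto_atTop_add_const_right _ h tendsto_id))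
  filter_upwards [h1.eventually_lt_const (show 0 < ε ^ 2 / (4 * a) * h by positivity),
    eventually_ge_atTop t₀] with t ht1 ht
  rw [Real.dist_0_eq_abs]
  by_contra! hcon
  have h2 (s) (hs : s ∈ Icc t (t + h)) : ε ^ 2 / 4 ≤ ψ s ^ 2 := by
    have h3 := abs_sub_le_of_hasDerivWithinAt_Ici hψ ht hs.1
      (fun u hu => hB u (ht.trans hu.1))
    have h4 : B * (s - t) ≤ ε / 2 := by
      have : B * (s - t) ≤ B * h := by gcongr; linarith [hs.2]
      refine this.trans_eq ?_
      rw [hh]; field_simp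
    have h5 : ε / 2 ≤ |ψ s| := by
      have := abs_sub_abs_le_abs_sub (ψ t) (ψ s)
      rw [abs_sub_comm] at this
      linarith
    rw [← sq_abs (ψ s)]
    nlinarith
  have h6 : AntitoneOn (fun s => H s + ε ^ 2 / (4 * a) * s) (Icc t (t + h)) := by
    refine antitoneOn_of_hasDerivWithinAt_nonpos (f' := fun s => H' s + ε ^ 2 / (4 * a) * 1)
      (convex_Icc _ _) (fun s hs => ?_) (fun s hs => ?_) (fun s hs => ?_)
    · exact (((hH s (ht.trans hs.1)).add ((hasDerivWithinAt_id s _).const_mul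
        (ε ^ 2 / (4 * a)))).mono fun u hu => ht.trans hu.1).continuousWithinAt
    · have hs' := interior_subset hs
      exact ((hH s (ht.trans hs'.1)).add ((hasDerivWithinAt_id s _).const_mul
        (ε ^ 2 / (4 * a)))).mono fun u hu => ht.trans (interior_subset hu).1
    · have hs' := interior_subset hs
      have h7 := (h2 s hs').trans (hle s (ht.trans hs'.1))
      have h8 : ε ^ 2 / (4 * a) ≤ -H' s := by
        rw [div_le_iff₀ (by positivity)]; nlinarith
      linarith
  have h9 := h6 (left_mem_Icc.2 (by linarith)) (right_mem_Icc.2 (by linarith))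
    (show t ≤ t + h by linarith)
  simp only at h9
  nlinarith

/-- If `ψ → 0` and `ψ' + u → 0`, then `u` cannot stay above a positive constant on unit intervals
starting at arbitrarily late times. -/
lemma false_of_lt_on_Icc {ψ ψ' u : ℝ → ℝ} {c : ℝ} (hc : 0 < c) {l : Filter ℝ} [l.NeBot]
    (hl : l ≤ atTop) (hψ : ∀ t ∈ Ici t₀, HasDerivWithinAt ψ (ψ' t) (Ici t₀) t)
    (h0 : Tendsto ψ atTop (𝓝 0)) (hu : Tendsto (fun t => ψ' t + u t) atTop (𝓝 0))
    (h : ∀ᶠ t in l, ∀ s ∈ Icc t (t + 1), c < u s) : False := by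
  have h1 : ∀ᶠ t in atTop, ∀ s, t ≤ s → ψ' s + u s < c / 2 :=
    eventually_forall_ge_atTop.2 (hu.eventually_lt_const (half_pos hc))
  -- On the unit interval ψ' < c/2 - c, so ψ falls by at least c/2, while two values below c/8 in
  -- modulus differ by less than c/4.
  have h2 : ∀ᶠ t in atTop, ∀ s, t ≤ s → |ψ s| < c / 8 := by
    have := eventually_forall_ge_atTop.2 (Metric.tendsto_nhds.1 h0 (c / 8) (by positivity))
    simpa only [Real.dist_0_eq_abs] using this
  obtain ⟨t, ht, ht1, ht2, ht0⟩ :=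
    (h.and (hl (h1.and (h2.and (eventually_ge_atTop t₀))))).exists
  have h3 : AntitoneOn (fun s => ψ s + c / 2 * s) (Icc t (t + 1)) := by
    refine antitoneOn_of_hasDerivWithinAt_nonpos (f' := fun s => ψ' s + c / 2 * 1)
      (convex_Icc _ _) (fun s hs => ?_) (fun s hs => ?_) (fun s hs => ?_)
    · exact (((hψ s (ht0.trans hs.1)).add ((hasDerivWithinAt_id s _).const_mul
        (c / 2))).mono fun u hu => ht0.trans hu.1).continuousWithinAt
    · have hs' := interior_subset hs
      exact ((hψ s (ht0.trans hs'.1)).add ((hasDerivWithinAt_id s _).const_mul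
        (c / 2))).mono fun u hu => ht0.trans (interior_subset hu).1
    · have hs' := interior_subset hs
      have := ht s hs'
      have := ht1 s hs'.1
      linarith
  have h4 := h3 (left_mem_Icc.2 (by linarith)) (right_mem_Icc.2 (by linarith))
    (show t ≤ t + 1 by linarith)
  simp only at h4
  have h5 := abs_lt.1 (ht2 t le_rfl)
  have h6 := abs_lt.1 (ht2 (t + 1) (by linarith))
  linarith [h5.1, h5.2, h6.1, h6.2]

/-- A function whose derivative tends to zero stays near its limits along a filter. -/
lemma eventually_Icc_mem_of_tendsto_coe {φ ψ : ℝ → ℝ} {l : Filter ℝ} (hl : l ≤ atTop)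
    (hφ : ∀ t ∈ Ici t₀, HasDerivWithinAt φ (ψ t) (Ici t₀) t) (h0 : Tendsto ψ atTop (𝓝 0))
    {x : EReal} (hx : Tendsto (fun t => (φ t : EReal)) l (𝓝 x)) {N : Set EReal} (hN : N ∈ 𝓝 x) :
    ∀ᶠ t in l, ∀ s ∈ Icc t (t + 1), (φ s : EReal) ∈ N := by
  have key (η : ℝ) (hη : 0 < η) : ∀ᶠ t in l, ∀ s ∈ Icc t (t + 1), |φ s - φ t| ≤ η := by
    refine hl ?_
    have h1 := eventually_forall_ge_atTop.2 (Metric.tendsto_nhds.1 h0 η hη)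
    filter_upwards [h1, eventually_ge_atTop t₀] with t ht ht0 s hs
    refine (abs_sub_le_of_hasDerivWithinAt_Ici hφ ht0 hs.1 (B := η) fun u hu => ?_).trans ?_
    · simpa only [Real.dist_0_eq_abs] using (ht u hu.1).le
    · nlinarith [hs.2]
  induction x with
  | bot =>
    obtain ⟨y, hy⟩ := EReal.mem_nhds_bot_iff.1 hN
    have h2 := hx.eventually_lt_const (EReal.bot_lt_coe (y - 1))
    filter_upwards [h2, key 1 one_pos] with t ht1 ht2 s hs
    refine hy (EReal.coe_lt_coe_iff.2 ?_)
    have := abs_le.1 (ht2 s hs)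
    have := EReal.coe_lt_coe_iff.1 ht1
    linarith
  | top =>
    obtain ⟨y, hy⟩ := EReal.mem_nhds_top_iff.1 hN
    have h2 := hx.eventually_const_lt (EReal.coe_lt_top (y + 1))
    filter_upwards [h2, key 1 one_pos] with t ht1 ht2 s hs
    refine hy (EReal.coe_lt_coe_iff.2 ?_)
    have := abs_le.1 (ht2 s hs)
    have := EReal.coe_lt_coe_iff.1 ht1
    linarith
  | coe x =>
    rw [EReal.nhds_coe, mem_map] at hN
    obtain ⟨η, hη, hball⟩ := Metric.mem_nhds_iff.1 hN
    have h2 := Metric.tendsto_nhds.1 (EReal.tendsto_coe.1 hx) (η / 2) (half_pos hη)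
    filter_upwards [h2, key (η / 2 / 2) (by positivity)] with t ht1 ht2 s hs
    refine hball ?_
    rw [Metric.mem_ball]
    have h3 := ht2 s hs
    rw [← Real.dist_eq] at h3
    linarith [dist_triangle (φ s) (φ t) x]

/-- Along a solution of `ψ' + u → 0`, `φ' = ψ → 0`, a force `u = W ∘ φ` that extends continuously
to the extended reals tends to zero. -/
lemma tendsto_force_zero {φ ψ ψ' u : ℝ → ℝ} {J : Set ℝ} {W : EReal → EReal}
    (hφ : ∀ t ∈ Ici t₀, HasDerivWithinAt φ (ψ t) (Ici t₀) t)
    (hψ : ∀ t ∈ Ici t₀, HasDerivWithinAt ψ (ψ' t) (Ici t₀) t)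
    (hJ : ∀ t ∈ Ici t₀, φ t ∈ J)
    (hW : ContinuousOn W (closure ((fun x : ℝ => (x : EReal)) '' J)))
    (hWu : ∀ t ∈ Ici t₀, W (φ t) = u t)
    (h0 : Tendsto ψ atTop (𝓝 0)) (hu : Tendsto (fun t => ψ' t + u t) atTop (𝓝 0)) :
    Tendsto u atTop (𝓝 0) := by
  set S := closure ((fun x : ℝ => (x : EReal)) '' J)
  have hS (t : ℝ) (ht : t ∈ Ici t₀) : (φ t : EReal) ∈ S :=
    subset_closure ⟨φ t, hJ t ht, rfl⟩
  -- Along an ultrafilter φ converges in the compact closure of J in the extended reals, although it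
  -- need not converge as t → ∞.
  rw [tendsto_iff_ultrafilter]
  intro l hl
  have hl0 : ∀ᶠ t in (l : Filter ℝ), t ∈ Ici t₀ := hl (eventually_ge_atTop t₀)
  obtain ⟨x, hxS, hx⟩ : ∃ x ∈ S, Tendsto (fun t => (φ t : EReal)) l (𝓝 x) :=
    (isClosed_closure.isCompact (s := S)).ultrafilter_le_nhds'
      (l.map fun t => (φ t : EReal)) (hl0.mono hS)
  have hWx : Tendsto (fun t => W (φ t)) l (𝓝 (W x)) :=
    (hW x hxS).tendsto.comp (tendsto_nhdsWithin_iff.2 ⟨hx, hl0.mono hS⟩)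
  have hnear {O : Set EReal} (hO : O ∈ 𝓝 (W x)) :
      ∀ᶠ t in (l : Filter ℝ), ∀ s ∈ Icc t (t + 1), (u s : EReal) ∈ O := by
    obtain ⟨N, hN, hNO⟩ := mem_nhdsWithin_iff_exists_mem_nhds_inter.1 (hW x hxS hO)
    filter_upwards [eventually_Icc_mem_of_tendsto_coe hl hφ h0 hx hN, hl0] with t ht ht0 s hs
    have hs0 : s ∈ Ici t₀ := le_trans ht0 hs.1
    rw [← hWu s hs0]
    exact hNO ⟨ht s hs, hS s hs0⟩
  -- A nonzero W x keeps u away from 0, with constant sign, on whole unit intervals, which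
  -- `false_of_lt_on_Icc` forbids. The negative case is reduced to the positive one by changing
  -- signs.
  rcases lt_trichotomy (W x) 0 with hneg | hzero | hpos
  · obtain ⟨r, hr1, hr2⟩ := EReal.lt_iff_exists_real_btwn.1 hneg
    have hr3 : r < 0 := by exact_mod_cast hr2
    refine (false_of_lt_on_Icc (ψ := fun t => -ψ t) (ψ' := fun t => -ψ' t) (u := fun t => -u t)
      (neg_pos.2 hr3) hl (fun t ht => (hψ t ht).neg) (by simpa using h0.neg) ?_ ?_).elim
    · refine (by simpa using hu.neg : Tendsto _ atTop (𝓝 (0 : ℝ))).congr fun t => ?_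
      ring
    · filter_upwards [hnear (Iio_mem_nhds hr1)] with t ht s hs
      exact neg_lt_neg (EReal.coe_lt_coe_iff.1 (ht s hs))
  · rw [hzero] at hWx
    refine EReal.tendsto_coe.1 (hWx.congr' ?_)
    filter_upwards [hl0] with t ht using hWu t ht
  · obtain ⟨r, hr1, hr2⟩ := EReal.lt_iff_exists_real_btwn.1 hpos
    have hr3 : 0 < r := by exact_mod_cast hr1
    refine (false_of_lt_on_Icc hr3 hl hψ h0 hu ?_).elim
    filter_upwards [hnear (Ioi_mem_nhds hr2)] with t ht s hs
    exact EReal.coe_lt_coe_iff.1 (ht s hs)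

end HalfLine

/-! ### The reduced system -/

/-- Solutions on `[t₀, ∞)` of the ordinary differential equations for the expansion rate `H` and the
scalar field `φ`, with `ψ = φ̇`, spatial curvature `R`, shear `s`, energy density `r`, pressure `p`,
coupling term `e`, potential energy `v` and force `u`. -/
structure ReducedSolution (n : ℕ) (t₀ C₀ H₀ : ℝ) (H H' φ ψ ψ' v u R s r p e : ℝ → ℝ) : Prop where
  three_le : 3 ≤ n
  H₀_pos : 0 < H₀
  hasDeriv_H : ∀ t ∈ Ici t₀, HasDerivWithinAt H (H' t) (Ici t₀) t
  hasDeriv_φ : ∀ t ∈ Ici t₀, HasDerivWithinAt φ (ψ t) (Ici t₀) t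
  hasDeriv_ψ : ∀ t ∈ Ici t₀, HasDerivWithinAt ψ (ψ' t) (Ici t₀) t
  hasDeriv_v : ∀ t ∈ Ici t₀, HasDerivWithinAt v (u t * ψ t) (Ici t₀) t
  hamiltonian : ∀ t ∈ Ici t₀, R t + n * (n - 1) * H t ^ 2 - s t = ψ t ^ 2 + 2 * v t + 2 * r t
  raychaudhuri : ∀ t ∈ Ici t₀,
    -(n * (n - 1) * H' t) = -R t + n * (s t + ψ t ^ 2) + (n * r t + p t)
  scalarField : ∀ t ∈ Ici t₀, ψ' t + n * H t * ψ t + u t = e t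
  R_nonpos : ∀ t ∈ Ici t₀, R t ≤ 0
  s_nonneg : ∀ t ∈ Ici t₀, 0 ≤ s t
  r_nonneg : ∀ t ∈ Ici t₀, 0 ≤ r t
  abs_p_le : ∀ t ∈ Ici t₀, |p t| ≤ n * r t
  strong : ∀ t ∈ Ici t₀, 0 ≤ r t + p t
  C₀_nonneg : 0 ≤ C₀
  abs_e_le : ∀ t ∈ Ici t₀, |e t| ≤ C₀ * r t
  v_ge : ∀ t ∈ Ici t₀, n * (n - 1) * H₀ ^ 2 ≤ 2 * v t
  H_init : 0 < H t₀

namespace ReducedSolution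

variable {n : ℕ} {t₀ C₀ H₀ : ℝ} {H H' φ ψ ψ' v u R s r p e : ℝ → ℝ}
  (S : ReducedSolution n t₀ C₀ H₀ H H' φ ψ ψ' v u R s r p e)

include S

lemma three_le_cast : (3 : ℝ) ≤ n := by exact_mod_cast S.three_le

lemma nn_pos : (0 : ℝ) < n * (n - 1) := by nlinarith [S.three_le_cast]

/-- The constraint forces H² ≥ H₀² > 0, so H cannot vanish and by continuity keeps its initial sign.
-/
lemma H_ge {t : ℝ} (ht : t ∈ Ici t₀) : H₀ ≤ H t := by
  have hsq (t) (ht : t ∈ Ici t₀) : H₀ ^ 2 ≤ H t ^ 2 := by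
    have := S.hamiltonian t ht
    have := S.R_nonpos t ht
    have := S.s_nonneg t ht
    have := S.r_nonneg t ht
    have := S.v_ge t ht
    refine le_of_mul_le_mul_left ?_ S.nn_pos
    nlinarith [sq_nonneg (ψ t)]
  have hne (t) (ht : t ∈ Ici t₀) : H t ≠ 0 := fun h0 => by
    have := hsq t ht
    rw [h0] at this
    nlinarith [S.H₀_pos]
  have hpos : 0 ≤ H t := by
    by_contra! hneg
    have hc : ContinuousOn H (Icc t₀ t) := fun x hx =>
      ((S.hasDeriv_H x hx.1).mono fun y hy => hy.1).continuousWithinAt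
    obtain ⟨x, hx, hx0⟩ := intermediate_value_Icc' ht hc ⟨hneg.le, S.H_init.le⟩
    exact hne x hx.1 hx0
  exact abs_le_of_sq_le_sq' (hsq t ht) hpos |>.2

lemma H_pos {t : ℝ} (ht : t ∈ Ici t₀) : 0 < H t := S.H₀_pos.trans_le (S.H_ge ht)

/-- In the Raychaudhuri equation -R, ns and nr + p are all non-negative, so nψ² alone is at most the
left-hand side. -/
lemma sq_ψ_le {t : ℝ} (ht : t ∈ Ici t₀) : ψ t ^ 2 ≤ -((n - 1) * H' t) := by
  have h1 := S.raychaudhuri t ht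
  have h2 := S.R_nonpos t ht
  have h3 := S.s_nonneg t ht
  have h4 := abs_le.1 (S.abs_p_le t ht)
  have hn : (0 : ℝ) < n := by linarith [S.three_le_cast]
  refine le_of_mul_le_mul_left ?_ hn
  nlinarith [mul_nonneg hn.le h3]

lemma antitoneOn_H : AntitoneOn H (Ici t₀) :=
  antitoneOn_Ici_of_hasDerivWithinAt S.hasDeriv_H fun t ht => by
    have h1 := S.sq_ψ_le ht
    have h2 := S.three_le_cast
    by_contra! h3
    nlinarith [sq_nonneg (ψ t), mul_pos (show (0 : ℝ) < n - 1 by linarith) h3]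

lemma exists_tendsto_H : ∃ L, H₀ ≤ L ∧ Tendsto H atTop (𝓝 L) :=
  exists_tendsto_of_antitoneOn_Ici S.antitoneOn_H fun _ ht => S.H_ge ht

/-- The energy `s - R + 2 r` decays exponentially. -/
lemma isBigO_energy {δ : ℝ} (hδ : 0 < δ) :
    (fun t => n * (n - 1) * H t ^ 2 - ψ t ^ 2 - 2 * v t)
      =O[atTop] fun t => Real.exp (-(2 - δ) * H₀ * t) := by
  have hn := S.three_le_cast
  refine isBigO_exp_of_deriv_le (K := C₀) (a := n - 1) (fun t ht =>
    ((((S.hasDeriv_H t ht).pow 2).const_mul ((n : ℝ) * (n - 1))).sub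
      ((S.hasDeriv_ψ t ht).pow 2)).sub ((S.hasDeriv_v t ht).const_mul 2)) S.hasDeriv_H
    (fun t ht => ?_) (by linarith) S.H₀_pos (fun t ht => S.H_ge ht) (fun t ht => S.sq_ψ_le ht)
    (fun t ht => ?_) hδ
  · change 0 ≤ (n : ℝ) * (n - 1) * H t ^ 2 - ψ t ^ 2 - 2 * v t
    have := S.hamiltonian t ht
    have := S.R_nonpos t ht
    have := S.s_nonneg t ht
    have := S.r_nonneg t ht
    linarith
  · have h1 := S.hamiltonian t ht
    have h2 := S.raychaudhuri t ht
    have h3 := S.scalarField t ht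
    have hR := S.R_nonpos t ht
    have hs := S.s_nonneg t ht
    have hr := S.r_nonneg t ht
    have hp := S.strong t ht
    have hH := S.H_pos ht
    have h4 : -(ψ t * e t) ≤ C₀ * |ψ t| * r t := by
      refine (neg_le_abs _).trans ?_
      rw [abs_mul]
      nlinarith [mul_le_mul_of_nonneg_left (S.abs_e_le t ht) (abs_nonneg (ψ t))]
    have h5 : (n : ℝ) * (n - 1) * H t ^ 2 - ψ t ^ 2 - 2 * v t = s t - R t + 2 * r t := by linarith
    have h6 : (n : ℝ) * (n - 1) * (2 * H t ^ 1 * H' t) - 2 * ψ t ^ 1 * ψ' t - 2 * (u t * ψ t)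
        = -2 * H t * (-R t + n * s t + (n * r t + p t)) - 2 * (ψ t * e t) := by
      rw [← h3]
      linear_combination (-2 * H t) * h2
    -- Here nr + p = (n-1)r + (r + p) ≥ 2r by the strong energy condition and n ≥ 3; this yields the
    -- rate 2H.
    have h7 : s t - R t + 2 * r t ≤ -R t + n * s t + (n * r t + p t) := by nlinarith
    have h8 := mul_le_mul_of_nonneg_left h7 hH.le
    have h9 : 0 ≤ C₀ * |ψ t| * (s t - R t) :=
      mul_nonneg (mul_nonneg S.C₀_nonneg (abs_nonneg _)) (by linarith)
    change _ ≤ _ * ((n : ℝ) * (n - 1) * H t ^ 2 - ψ t ^ 2 - 2 * v t)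
    rw [h5]
    norm_num at h6 ⊢
    linarith

/-- By the constraint, s - R + 2r is the energy whose decay is known; its summands are non-negative,
so it controls each of them. -/
lemma isBigO_of_abs_le {f : ℝ → ℝ} {c : ℝ} (hc : 0 ≤ c)
    (hf : ∀ t ∈ Ici t₀, |f t| ≤ c * (s t - R t + 2 * r t)) {δ : ℝ} (hδ : 0 < δ) :
    f =O[atTop] fun t => Real.exp (-(2 - δ) * H₀ * t) := by
  refine IsBigO.trans (IsBigO.of_bound c ?_) (S.isBigO_energy hδ)
  filter_upwards [eventually_ge_atTop t₀] with t ht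
  have h1 := S.hamiltonian t ht
  have h2 : (n : ℝ) * (n - 1) * H t ^ 2 - ψ t ^ 2 - 2 * v t = s t - R t + 2 * r t := by linarith
  rw [h2]
  exact (hf t ht).trans (mul_le_mul_of_nonneg_left (le_abs_self _) hc)

lemma isBigO_R {δ : ℝ} (hδ : 0 < δ) :
    R =O[atTop] fun t => Real.exp (-(2 - δ) * H₀ * t) :=
  S.isBigO_of_abs_le zero_le_one (fun t ht => by
    rw [abs_of_nonpos (S.R_nonpos t ht)]
    linarith [S.s_nonneg t ht, S.r_nonneg t ht]) hδ

lemma isBigO_s {δ : ℝ} (hδ : 0 < δ) :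
    s =O[atTop] fun t => Real.exp (-(2 - δ) * H₀ * t) :=
  S.isBigO_of_abs_le zero_le_one (fun t ht => by
    rw [abs_of_nonneg (S.s_nonneg t ht)]
    linarith [S.R_nonpos t ht, S.r_nonneg t ht]) hδ

lemma isBigO_of_abs_le_r {f : ℝ → ℝ} {c : ℝ} (hc : 0 ≤ c) (hf : ∀ t ∈ Ici t₀, |f t| ≤ c * r t)
    {δ : ℝ} (hδ : 0 < δ) : f =O[atTop] fun t => Real.exp (-(2 - δ) * H₀ * t) :=
  S.isBigO_of_abs_le hc (fun t ht => (hf t ht).trans (mul_le_mul_of_nonneg_left (by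
    linarith [S.R_nonpos t ht, S.s_nonneg t ht, S.r_nonneg t ht]) hc)) hδ

lemma tendsto_zero_of_isBigO {f : ℝ → ℝ}
    (hf : ∀ δ : ℝ, 0 < δ → f =O[atTop] fun t => Real.exp (-(2 - δ) * H₀ * t)) :
    Tendsto f atTop (𝓝 0) := by
  refine (hf 1 one_pos).trans_tendsto (Real.tendsto_exp_atBot.comp ?_)
  have : (-(2 - 1) * H₀ : ℝ) < 0 := by linarith [S.H₀_pos]
  exact tendsto_id.const_mul_atTop_of_neg this

lemma energy_le {t : ℝ} (ht : t ∈ Ici t₀) :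
    ψ t ^ 2 ≤ n * (n - 1) * H t₀ ^ 2 ∧ 2 * v t ≤ n * (n - 1) * H t₀ ^ 2 ∧
      2 * r t ≤ n * (n - 1) * H t₀ ^ 2 := by
  have h1 := S.hamiltonian t ht
  have h2 := S.R_nonpos t ht
  have h3 := S.s_nonneg t ht
  have h4 := S.r_nonneg t ht
  have h5 := S.v_ge t ht
  have h6 := sq_nonneg (ψ t)
  have h7 : (n : ℝ) * (n - 1) * H t ^ 2 ≤ n * (n - 1) * H t₀ ^ 2 :=
    mul_le_mul_of_nonneg_left (pow_le_pow_left₀ (S.H_pos ht).le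
      (S.antitoneOn_H self_mem_Ici ht ht) 2) S.nn_pos.le
  have h8 : 0 ≤ n * (n - 1) * H₀ ^ 2 := mul_nonneg S.nn_pos.le (sq_nonneg _)
  refine ⟨?_, ?_, ?_⟩ <;> linarith

lemma isBigO_e {δ : ℝ} (hδ : 0 < δ) : e =O[atTop] fun t => Real.exp (-(2 - δ) * H₀ * t) :=
  S.isBigO_of_abs_le_r S.C₀_nonneg S.abs_e_le hδ

/-- The scalar field equation bounds ψ' once u is bounded, and ψ² is dominated by the derivative of
the convergent function H. -/
lemma tendsto_ψ {B : ℝ} (hB : ∀ t ∈ Ici t₀, |u t| ≤ B) : Tendsto ψ atTop (𝓝 0) := by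
  obtain ⟨L, -, hL⟩ := S.exists_tendsto_H
  have hn := S.three_le_cast
  set M := n * (n - 1) * H t₀ ^ 2
  refine tendsto_zero_of_sq_le (a := n - 1) (B := C₀ * M + n * H t₀ * (1 + M) + B) (by linarith)
    S.hasDeriv_H S.hasDeriv_ψ (fun t ht => ?_) (fun t ht => S.sq_ψ_le ht) hL
  obtain ⟨h1, -, h2⟩ := S.energy_le ht
  have h3 : |e t| ≤ C₀ * M := (S.abs_e_le t ht).trans
    (mul_le_mul_of_nonneg_left (by linarith [S.r_nonneg t ht]) S.C₀_nonneg)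
  -- The crude consequence of ψ² ≤ M avoids a square root.
  have h4 : |ψ t| ≤ 1 + M := by
    rw [← sq_abs] at h1
    nlinarith [sq_nonneg (|ψ t| - 1)]
  have h5 : |n * H t * ψ t| ≤ n * H t₀ * (1 + M) := by
    rw [abs_mul, abs_of_nonneg (mul_nonneg (by linarith) (S.H_pos ht).le)]
    have := S.antitoneOn_H self_mem_Ici ht ht
    have := S.H_init
    gcongr
  have h6 : ψ' t = e t - n * H t * ψ t - u t := by linarith [S.scalarField t ht]
  rw [h6]
  exact (abs_sub _ _).trans (add_le_add ((abs_sub _ _).trans (add_le_add h3 h5)) (hB t ht))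

/-- The sum of acceleration and force tends to zero. -/
lemma tendsto_ψ'_add_u {B : ℝ} (hB : ∀ t ∈ Ici t₀, |u t| ≤ B) :
    Tendsto (fun t => ψ' t + u t) atTop (𝓝 0) := by
  obtain ⟨L, -, hL⟩ := S.exists_tendsto_H
  have h1 : Tendsto (fun t => e t - n * H t * ψ t) atTop (𝓝 (0 - n * L * 0)) :=
    (S.tendsto_zero_of_isBigO fun _ hδ => S.isBigO_e hδ).sub
      ((hL.const_mul (n : ℝ)).mul (S.tendsto_ψ hB))
  rw [mul_zero, sub_zero] at h1
  refine h1.congr' ?_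
  filter_upwards [eventually_ge_atTop t₀] with t ht
  linarith [S.scalarField t ht]

/-- In the definition of the energy both the energy and ψ² tend to 0, so 2v has the same limit as
n(n-1)H². -/
lemma tendsto_v {B L : ℝ} (hB : ∀ t ∈ Ici t₀, |u t| ≤ B) (hL : Tendsto H atTop (𝓝 L)) :
    Tendsto v atTop (𝓝 (1 / 2 * n * (n - 1) * L ^ 2)) := by
  have h1 := S.tendsto_zero_of_isBigO fun _ hδ => S.isBigO_energy hδ
  have h2 := ((((hL.pow 2).const_mul ((n : ℝ) * (n - 1))).sub
    ((S.tendsto_ψ hB).pow 2)).sub h1).const_mul (1 / 2)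
  refine (h2.congr fun t => ?_).trans (le_of_eq ?_)
  · ring
  · congr 1; ring

lemma tendsto_H' {B : ℝ} (hB : ∀ t ∈ Ici t₀, |u t| ≤ B) : Tendsto H' atTop (𝓝 0) := by
  have hs := S.tendsto_zero_of_isBigO fun _ hδ => S.isBigO_s hδ
  have hR := S.tendsto_zero_of_isBigO fun _ hδ => S.isBigO_R hδ
  have hr := S.tendsto_zero_of_isBigO fun _ hδ => S.isBigO_of_abs_le_r (f := r) zero_le_one
    (fun t ht => by rw [abs_of_nonneg (S.r_nonneg t ht), one_mul]) hδ
  have hp := S.tendsto_zero_of_isBigO fun _ hδ =>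
    S.isBigO_of_abs_le_r (Nat.cast_nonneg n) S.abs_p_le hδ
  have h1 := ((hR.neg.add ((hs.add ((S.tendsto_ψ hB).pow 2)).const_mul (n : ℝ))).add
    ((hr.const_mul (n : ℝ)).add hp)).const_mul (-((n : ℝ) * (n - 1))⁻¹)
  norm_num at h1
  refine h1.congr' ?_
  filter_upwards [eventually_ge_atTop t₀] with t ht
  have h2 := S.raychaudhuri t ht
  rw [← mul_inv_rev, ← h2, mul_neg, neg_neg, inv_mul_cancel_left₀ S.nn_pos.ne']

lemma tendsto_q {B : ℝ} (hB : ∀ t ∈ Ici t₀, |u t| ≤ B) :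
    Tendsto (fun t => -1 - H' t / H t ^ 2) atTop (𝓝 (-1)) := by
  obtain ⟨L, hL0, hL⟩ := S.exists_tendsto_H
  have h1 := ((S.tendsto_H' hB).div (hL.pow 2)
    (pow_pos (S.H₀_pos.trans_le hL0) 2).ne').const_sub (-1)
  simpa using h1

lemma isBigO_sqrt_s_div {δ : ℝ} (hδ : 0 < δ) :
    (fun t => Real.sqrt (s t) / H t) =O[atTop] fun t => Real.exp (-(1 - δ) * H₀ * t) := by
  -- The rate is taken with loss 2δ because the square root halves the exponent.
  obtain ⟨c, hc0, hc⟩ := (S.isBigO_s (mul_pos two_pos hδ)).exists_nonneg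
  refine IsBigO.of_bound (Real.sqrt c / H₀) ?_
  filter_upwards [hc.bound, eventually_ge_atTop t₀] with t h1 ht
  have hH := S.H_pos ht
  rw [Real.norm_of_nonneg (S.s_nonneg t ht), Real.norm_of_nonneg (Real.exp_pos _).le] at h1
  rw [Real.norm_of_nonneg (by positivity), Real.norm_of_nonneg (Real.exp_pos _).le]
  have h2 : Real.exp (-(2 - 2 * δ) * H₀ * t) = Real.exp (-(1 - δ) * H₀ * t) ^ 2 := by
    rw [← Real.exp_nat_mul]; congr 1; push_cast; ring
  have h3 : Real.sqrt (s t) ≤ Real.sqrt c * Real.exp (-(1 - δ) * H₀ * t) := by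
    refine (Real.sqrt_le_sqrt h1).trans_eq ?_
    rw [h2, Real.sqrt_mul hc0, Real.sqrt_sq (Real.exp_pos _).le]
  calc Real.sqrt (s t) / H t ≤ Real.sqrt c * Real.exp (-(1 - δ) * H₀ * t) / H₀ :=
        div_le_div₀ (by positivity) h3 S.H₀_pos (S.H_ge ht)
    _ = _ := by ring

end ReducedSolution

/-! ### Reduction of the homogeneous model to the ordinary differential equations. -/

namespace Model

variable {n : ℕ} {𝔤 : Type*} [LieRing 𝔤] [LieAlgebra ℝ 𝔤] {m : Model 𝔤}
  (b : Module.Basis (Fin n) ℝ 𝔤)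

lemma normJ_nonneg (m : Model 𝔤) (t : ℝ) : 0 ≤ m.normJ b t := Real.sqrt_nonneg _

lemma Regular.hasDerivWithinAt_φ (h : m.Regular) {t : ℝ} (ht : t ∈ m.I) :
    HasDerivWithinAt m.φ (m.dot m.φ t) m.I t :=
  (h.contDiffOn_φ.differentiableOn (by norm_num) t ht).hasDerivWithinAt

lemma Regular.hasDerivWithinAt_dot_φ (h : m.Regular) {t : ℝ} (ht : t ∈ m.I) :
    HasDerivWithinAt (m.dot m.φ) (m.dot (m.dot m.φ) t) m.I t :=
  ((h.contDiffOn_φ.derivWithin m.uniqueDiffOn_I (m := 1) (by norm_num)).differentiableOn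
    (by norm_num) t ht).hasDerivWithinAt

lemma Regular.hasDerivWithinAt_V (h : m.Regular) {t : ℝ} (ht : t ∈ m.I) :
    HasDerivWithinAt (fun t => m.V (m.φ t)) (m.dV (m.φ t) * m.dot m.φ t) m.I t :=
  ((h.contDiffOn_V.differentiableOn (by norm_num) _
    (h.mapsTo_φ ht)).hasDerivWithinAt).comp t (h.hasDerivWithinAt_φ ht) h.mapsTo_φ

lemma bddBelow_V (h : m.Regular) (hV : ∀ x ∈ m.J, 0 < m.V x) :
    BddBelow ((fun t => m.V (m.φ t)) '' m.I) :=
  ⟨0, by rintro _ ⟨t, ht, rfl⟩; exact (hV _ (h.mapsTo_φ ht)).le⟩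

/-- A homogeneous model reduces to a system of ordinary differential equations. -/
lemma reducedSolution (hn : 3 ≤ n) (hG : NonposScalarCurvature b) (hreg : m.Regular)
    (hESM : m.SolvesESM b) (hDEC : m.DEC b) (hSEC : m.SEC b) (hC : ∀ x ∈ m.J, 0 ≤ m.C x)
    {C₀ : ℝ} (hc : ∀ x ∈ m.J, |m.c x| ≤ C₀ * m.C x)
    (hV : ∀ x ∈ m.J, 0 < m.V x) (hexp : 0 < m.H b m.t₀) (hV₀ : 0 < m.V₀) :
    ReducedSolution n m.t₀ (|C₀| * (n + 1)) (m.H₀ n) (m.H b) (m.dot (m.H b)) m.φ (m.dot m.φ)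
      (m.dot (m.dot m.φ)) (fun t => m.V (m.φ t)) (fun t => m.dV (m.φ t))
      (fun t => scalarCurvature b (m.γ t)) (m.shearSq b) (fun t => m.C (m.φ t) * m.ρ t)
      (fun t => m.C (m.φ t) * m.trS b t) (fun t => m.c (m.φ t) * m.trT b t) := by
  have hn3 : (3 : ℝ) ≤ n := by exact_mod_cast hn
  have hn0 : n ≠ 0 := by omega
  have hnn : (0 : ℝ) < n * (n - 1) := by nlinarith
  have hC' {t} (ht : t ∈ m.I) := hC _ (hreg.mapsTo_φ ht)
  have hρ {t} (ht : t ∈ m.I) : 0 ≤ m.ρ t := (m.normJ_nonneg b t).trans (hDEC t ht).1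
  refine
    { three_le := hn
      H₀_pos := Real.sqrt_pos.2 (by positivity)
      hasDeriv_H := fun t ht => (hreg.differentiableWithinAt_H b ht).hasDerivWithinAt
      hasDeriv_φ := fun t ht => hreg.hasDerivWithinAt_φ ht
      hasDeriv_ψ := fun t ht => hreg.hasDerivWithinAt_dot_φ ht
      hasDeriv_v := fun t ht => hreg.hasDerivWithinAt_V ht
      hamiltonian := fun t ht => hESM.hamiltonian b hreg hn0 ht
      raychaudhuri := fun t ht => hESM.raychaudhuri b hreg hn ht
      scalarField := fun t ht => by
        rw [trT_eq b hreg ht]; exact hESM.scalarField_eq b hreg hn0 ht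
      R_nonpos := fun t ht => hG _ (hreg.isRiemannian_γ t ht)
      s_nonneg := fun t ht => shearSq_nonneg b hreg ht
      r_nonneg := fun t ht => mul_nonneg (hC' ht) (hρ ht)
      abs_p_le := fun t ht => ?_
      strong := fun t ht => ?_
      C₀_nonneg := by positivity
      abs_e_le := fun t ht => ?_
      v_ge := fun t ht => ?_
      H_init := hexp }
  · rw [abs_mul, abs_of_nonneg (hC' ht), mul_left_comm]
    exact mul_le_mul_of_nonneg_left (hDEC t ht).2 (hC' ht)
  · rw [← mul_add]
    exact mul_nonneg (hC' ht) (hSEC t ht)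
  -- Since tr T = tr S - ρ, the dominant energy condition gives the factor n + 1. The absolute value
  -- of `C₀` covers a negative constant.
  · have h1 : |m.trT b t| ≤ (n + 1) * m.ρ t := by
      rw [trT_eq b hreg ht]
      refine (abs_sub _ _).trans ?_
      rw [abs_of_nonneg (hρ ht)]
      linarith [(hDEC t ht).2]
    have h2 : |m.c (m.φ t)| ≤ |C₀| * m.C (m.φ t) := (hc _ (hreg.mapsTo_φ ht)).trans
      (mul_le_mul_of_nonneg_right (le_abs_self _) (hC' ht))
    rw [abs_mul]
    refine (mul_le_mul h2 h1 (abs_nonneg _) (mul_nonneg (abs_nonneg _) (hC' ht))).trans_eq ?_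
    ring
  · have h1 : m.V₀ ≤ m.V (m.φ t) := csInf_le (bddBelow_V hreg hV) ⟨t, ht, rfl⟩
    rw [H₀, Real.sq_sqrt (by positivity)]
    refine le_of_eq_of_le ?_ (mul_le_mul_of_nonneg_left h1 two_pos.le)
    exact mul_div_cancel₀ _ hnn.ne'

end Model

end Quintessence

/-! ### The asymptotics of the model. -/

open Quintessence
theorem mainTheorem2 {n : ℕ} (hn : 3 ≤ n)
    {E : Type*} [NormedAddCommGroup E] [NormedSpace ℝ E] [FiniteDimensional ℝ E] [CompleteSpace E]
    {G : Type*} [TopologicalSpace G] [ChartedSpace E G] [Group G] [LieGroup 𝓘(ℝ, E) ∞ G]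
    (b : Module.Basis (Fin n) ℝ (GroupLieAlgebra 𝓘(ℝ, E) G))
    (hG : NonposScalarCurvature b)
    (m : Model (GroupLieAlgebra 𝓘(ℝ, E) G))
    (hreg : m.Regular) (hESM : m.SolvesESM b)
    (hDEC : m.DEC b) (hSEC : m.SEC b)
    (hC : ∀ x ∈ m.J, 0 ≤ m.C x)
    (hc : ∃ C₀ : ℝ, ∀ x ∈ m.J, |m.c x| ≤ C₀ * m.C x)
    (hV : ∀ x ∈ m.J, 0 < m.V x) (hP1 : m.P1) (hP2 : m.P2) (hP3 : m.P3)
    (hexp : 0 < m.H b m.t₀) (hV₀ : 0 < m.V₀) :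
    -- decay of curvature, shear, matter terms and coupling term
    (∀ δ : ℝ, 0 < δ →
      (fun t => scalarCurvature b (m.γ t)) =O[atTop] (fun t => Real.exp (-(2 - δ) * m.H₀ n * t)) ∧
      (fun t => m.shearSq b t) =O[atTop] (fun t => Real.exp (-(2 - δ) * m.H₀ n * t)) ∧
      (fun t => m.C (m.φ t) * m.ρ t) =O[atTop] (fun t => Real.exp (-(2 - δ) * m.H₀ n * t)) ∧
      (fun t => m.C (m.φ t) * m.normJ b t) =O[atTop]
        (fun t => Real.exp (-(2 - δ) * m.H₀ n * t)) ∧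
      (fun t => m.C (m.φ t) * m.trS b t) =O[atTop]
        (fun t => Real.exp (-(2 - δ) * m.H₀ n * t)) ∧
      (fun t => m.c (m.φ t) * m.trT b t) =O[atTop]
        (fun t => Real.exp (-(2 - δ) * m.H₀ n * t))) ∧
    -- limits of the expansion rate, the potential energy and the field derivatives
    (∃ Hinf : ℝ, 0 < m.H₀ n ∧ m.H₀ n ≤ Hinf ∧
      Tendsto (m.H b) atTop (𝓝 Hinf) ∧
      0 < (1 / 2) * (n : ℝ) * ((n : ℝ) - 1) * Hinf ^ 2 ∧
      Tendsto (fun t => m.V (m.φ t)) atTop (𝓝 ((1 / 2) * (n : ℝ) * ((n : ℝ) - 1) * Hinf ^ 2)) ∧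
      Tendsto (fun t => m.dV (m.φ t)) atTop (𝓝 0) ∧
      Tendsto (m.dot m.φ) atTop (𝓝 0) ∧
      Tendsto (m.dot (m.dot m.φ)) atTop (𝓝 0)) ∧
    -- exponential acceleration and isotropization
    Tendsto (m.q b) atTop (𝓝 (-1)) ∧
    (∀ δ : ℝ, 0 < δ →
      (fun t => Real.sqrt (m.shearSq b t) / m.H b t) =O[atTop]
        (fun t => Real.exp (-(1 - δ) * m.H₀ n * t))) := by
  obtain ⟨C₀, hc⟩ := hc
  have S := Model.reducedSolution b hn hG hreg hESM hDEC hSEC hC hc hV hexp hV₀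
  obtain ⟨B, hB⟩ : ∃ B, ∀ t ∈ Ici m.t₀, |m.dV (m.φ t)| ≤ B := by
    -- The constraint and monotonicity of H bound V along the solution, so (P2) applies to the range
    -- of φ.
    have h1 := hP2 (m.φ '' Ici m.t₀) (image_subset_iff.2 hreg.mapsTo_φ) (by
      refine (Metric.isBounded_Icc 0 (n * (n - 1) * m.H b m.t₀ ^ 2)).subset ?_
      rintro _ ⟨_, ⟨t, ht, rfl⟩, rfl⟩
      have h2 := hV _ (hreg.mapsTo_φ ht)
      exact ⟨h2.le, by linarith [(S.energy_le ht).2.1]⟩)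
    obtain ⟨B, hB⟩ := h1.exists_norm_le
    exact ⟨B, fun t ht => hB _ ⟨_, ⟨t, ht, rfl⟩, rfl⟩⟩
  obtain ⟨W, hW, hWV⟩ := hP3
  have hψ := S.tendsto_ψ hB
  have hψu := S.tendsto_ψ'_add_u hB
  have hu := tendsto_force_zero S.hasDeriv_φ S.hasDeriv_ψ (fun t ht => hreg.mapsTo_φ ht) hW
    (fun t ht => hWV _ (hreg.mapsTo_φ ht)) hψ hψu
  obtain ⟨L, hL0, hL⟩ := S.exists_tendsto_H
  have hL2 : 0 < L := S.H₀_pos.trans_le hL0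
  refine ⟨fun δ hδ => ⟨S.isBigO_R hδ, S.isBigO_s hδ, ?_, ?_, ?_, S.isBigO_e hδ⟩,
    ⟨L, S.H₀_pos, hL0, hL, ?_, S.tendsto_v hB hL, hu, hψ, ?_⟩, S.tendsto_q hB,
    fun δ hδ => S.isBigO_sqrt_s_div hδ⟩
  · refine S.isBigO_of_abs_le_r zero_le_one (fun t ht => ?_) hδ
    rw [abs_of_nonneg (S.r_nonneg t ht), one_mul]
  · refine S.isBigO_of_abs_le_r zero_le_one (fun t ht => ?_) hδ
    have hCt := hC _ (hreg.mapsTo_φ ht)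
    rw [abs_of_nonneg (mul_nonneg hCt (m.normJ_nonneg b t)), one_mul]
    exact mul_le_mul_of_nonneg_left (hDEC t ht).1 hCt
  · exact S.isBigO_of_abs_le_r (Nat.cast_nonneg n) S.abs_p_le hδ
  · have := mul_pos S.nn_pos (pow_pos hL2 2)
    linarith
  -- The second derivative of φ is the difference of φ̈ + V'(φ) and V'(φ), both of which tend to 0.
  · simpa using hψu.sub hu
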